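/- **$d$-linear Bell bound.** For $d\ge 1$ and $t=\sum_i t_i\, e_{i(1)}\otimes\cdots\otimes e_{i(d)}\in \ell_1^{n_1}\otimes\cdots\otimes\ell_1^{n_d}$ (complex scalars) let $$\|t\|_{\min}=\sup\Big\|\sum_i t_i\,u^{(1)}_{i(1)}\otimes\cdots\otimes u^{(d)}_{i(d)}\Big\|_{B(H\otimes_2\cdots\otimes_2H)},\qquad \|t\|_\vee=\sup\Big|\sum_i t_i\,x^{(1)}_{i(1)}\cdots x^{(d)}_{i(d)}\Big|,$$ the first supremum over all complex Hilbert spaces $H$ and all unitary operators $u^{(j)}_k$ on $H$, the second over all unimodular complex scalars $x^{(j)}_k$. Let $C_d(n_1,\dots,n_d)=\sup\{\|t\|_{\min}: \|t\|_\vee\le 1\}$. For complex arrays $g,g'$ indexed by $[N_1]\times\cdots\times[N_d]$, $N_j\ge1$, let $$T_{g,g'}=\sum g_{i(1),\dots,i(d)}\,g'_{i'(1),\dots,i'(d)}\;e_{i(1)i'(1)}\otimes\cdots\otimes e_{i(d)i'(d)},$$ let $\|T\|_\vee$ denote the norm of $T$ in the injective tensor product $\ell_2^{N_1^2}\overset{\vee}{\otimes}\cdots\overset{\vee}{\otimes}\ell_2^{N_d^2}$,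 and let $\|g\|_2=(\sum|g_{i(1),\dots,i(d)}|^2)^{1/2}$. Given, for each $j$, a basis $(u^{(j)}_k)_{k\le N_j^2}$ of the space of $N_j\times N_j$ complex matrices that is orthogonal for the Hilbert–Schmidt inner product and consists of unitary matrices, put $$t_{g,g'}=\sum_{k}\hat T(k)\,e_{k(1)}\otimes\cdots\otimes e_{k(d)}\in\ell_1^{N_1^2}\otimes\cdots\otimes\ell_1^{N_d^2},\qquad \hat T(k)=(N_1\cdots N_d)^{-1}\big\langle T_{g,g'},u^{(1)}_{k(1)}\otimes\cdots\otimes u^{(d)}_{k(d)}\big\rangle .$$ 1. For all $N_1,\dots,N_d\ge1$, all such bases and all $g,g'$, $$\|t_{g,g'}\|_{\min}\ge \|g\|_2\|g'\|_2,\qquad \|t_{g,g'}\|_\vee\le (N_1\cdots N_d)^{1/2}\,\|T_{g,g'}\|_\vee .$$ 2. For all $N_1,\dots,N_d\ge1$ and all $g,g'$ with $\|g\|_2\|g'\|_2=1$, $$C_d(N_1^2,\dots,N_d^2)\ge (N_1\cdots N_d)^{-1/2}\,\|T_{g,g'}\|_\vee^{-1}.$$ 3. There are $c,C,\kappa>0$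 depending only on $d$ such that for all $N\ge2$ (with $N_1=\dots=N_d=N$) and all such bases, if the $2N^d$ entries of $g$ and $g'$ are i.i.d. standard real Gaussian variables, then with probability at least $1-e^{-\kappa N}$ $$\|t_{g,g'}\|_{\min}\ge cN^d,\qquad \|T_{g,g'}\|_\vee\le C N(\log N)^{d/2},\qquad \|t_{g,g'}\|_\vee\le C N^{d/2}\,N(\log N)^{d/2}.$$ 4. There is $c_d>0$ depending only on $d$ such that for all $N\ge2$ $$C_d(N^2,\dots,N^2)\ge c_d\,N^{d/2-1}(\log N)^{-d/2}.$$ -/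

import Mathlib

open scoped TensorProduct

noncomputable section

namespace BellTensor

/-! ### Hilbert tensor powers and the operators `u₁ ⊗ ⋯ ⊗ u_d` on them -/

/-- A bundled complex inner product space. -/
structure PreHilbert where
  carrier : Type
  [normedAddCommGroup : NormedAddCommGroup carrier]
  [innerProductSpace : InnerProductSpace ℂ carrier]

attribute [instance] PreHilbert.normedAddCommGroup PreHilbert.innerProductSpace

/-- The algebraic tensor power `H ⊗ (H ⊗ (⋯ ⊗ ℂ))` (`d` factors `H`), with the inner product
determined by `⟪x₁ ⊗ ⋯ ⊗ x_d, y₁ ⊗ ⋯ ⊗ y_d⟫ = ∏ j, ⟪x_j, y_j⟫`. -/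
def algTensorPower (H : Type) [NormedAddCommGroup H] [InnerProductSpace ℂ H] : ℕ → PreHilbert
  | 0 => ⟨ℂ⟩
  | d + 1 => ⟨H ⊗[ℂ] (algTensorPower H d).carrier⟩

/-- The operator `u₁ ⊗ ⋯ ⊗ u_d` on the algebraic tensor power, for unitary operators `u_j` on `H`.
It is isometric. -/
def algTensorOp {H : Type} [NormedAddCommGroup H] [InnerProductSpace ℂ H] :
    (d : ℕ) → (Fin d → (H ≃ₗᵢ[ℂ] H)) →
      ((algTensorPower H d).carrier →ₗᵢ[ℂ] (algTensorPower H d).carrier)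
  | 0, _ => LinearIsometry.id
  | d + 1, u => TensorProduct.mapIsometry (u 0).toLinearIsometry (algTensorOp d (Fin.tail u))

/-- The Hilbert space tensor product `H ⊗₂ ⋯ ⊗₂ H` (`d` factors): the completion of the algebraic
tensor power. -/
abbrev HilbertTensorPower (H : Type) [NormedAddCommGroup H] [InnerProductSpace ℂ H] (d : ℕ) :
    Type :=
  UniformSpace.Completion (algTensorPower H d).carrier

/-- The bounded operator `u₁ ⊗ ⋯ ⊗ u_d` on `H ⊗₂ ⋯ ⊗₂ H`. -/
def tensorOp {H : Type} [NormedAddCommGroup H] [InnerProductSpace ℂ H] {d : ℕ}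
    (u : Fin d → (H ≃ₗᵢ[ℂ] H)) : HilbertTensorPower H d →L[ℂ] HilbertTensorPower H d :=
  (algTensorOp d u).toContinuousLinearMap.completion

/-! ### Norms on tensors, given by their arrays of coefficients -/

/-- The value `∑ i, t i * x₁ (i 1) * ⋯ * x_d (i d)`. -/
def multiform {d : ℕ} {ι : Fin d → Type} [∀ j, Fintype (ι j)]
    (t : (∀ j, ι j) → ℂ) (x : ∀ j, ι j → ℂ) : ℂ :=
  ∑ i, t i * ∏ j, x j (i j)

/-- The minimal norm of `t = ∑ i, t i • e_{i 1} ⊗ ⋯ ⊗ e_{i d}` in `ℓ₁^{n 1} ⊗ ⋯ ⊗ ℓ₁^{n d}`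
(each `ℓ₁^n` with its maximal operator space structure): the supremum of the operator norms of
`∑ i, t i • u₁ (i 1) ⊗ ⋯ ⊗ u_d (i d)` over all Hilbert spaces `H` and all families of
unitary operators `u_j k` on `H`. -/
def minNorm {d : ℕ} {n : Fin d → ℕ} (t : (∀ j, Fin (n j)) → ℂ) : ℝ :=
  sSup {r : ℝ | ∃ (H : Type) (_ : NormedAddCommGroup H) (_ : InnerProductSpace ℂ H)
    (_ : CompleteSpace H) (u : ∀ j, Fin (n j) → (H ≃ₗᵢ[ℂ] H)),
    r = ‖∑ i : (∀ j, Fin (n j)), t i • tensorOp (fun j => u j (i j))‖}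

/-- The injective norm of `t` in `ℓ₁^{n 1} ⊗ ⋯ ⊗ ℓ₁^{n d}`: the supremum of
`|∑ i, t i * x₁ (i 1) * ⋯ * x_d (i d)|` over all unimodular complex scalars `x_j k`. -/
def injNorm {d : ℕ} {n : Fin d → ℕ} (t : (∀ j, Fin (n j)) → ℂ) : ℝ :=
  sSup {r : ℝ | ∃ x : ∀ j, Fin (n j) → ℂ, (∀ j k, ‖x j k‖ = 1) ∧ r = ‖multiform t x‖}

/-- `C_d(n 1, …, n d)`: the supremum of the minimal norm over the unit ball of the injective norm
of `ℓ₁^{n 1} ⊗ ⋯ ⊗ ℓ₁^{n d}`. -/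
def bellConst {d : ℕ} (n : Fin d → ℕ) : ℝ :=
  sSup {r : ℝ | ∃ t : (∀ j, Fin (n j)) → ℂ, injNorm t ≤ 1 ∧ r = minNorm t}

/-- The injective norm in `ℓ₂(ι 1) ⊗ ⋯ ⊗ ℓ₂(ι d)`: the supremum of
`|∑ i, T i * x₁ (i 1) * ⋯ * x_d (i d)|` over all `x_j` in the unit balls of `ℓ₂(ι j)`. -/
def injNormHilbert {d : ℕ} {ι : Fin d → Type} [∀ j, Fintype (ι j)]
    (T : (∀ j, ι j) → ℂ) : ℝ :=
  sSup {r : ℝ | ∃ x : ∀ j, EuclideanSpace ℂ (ι j), (∀ j, ‖x j‖ ≤ 1) ∧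
    r = ‖multiform T (fun j k => x j k)‖}

/-- The Euclidean norm `(∑ i, |g i|²)^{1/2}` of a finite array. -/
def l2Norm {ι : Type} [Fintype ι] (g : ι → ℂ) : ℝ :=
  Real.sqrt (∑ i, ‖g i‖ ^ 2)

/-! ### The tensors of the construction -/

/-- The tensor `T = ∑ g_{i 1,…,i d} g'_{i' 1,…,i' d} e_{i 1, i' 1} ⊗ ⋯ ⊗ e_{i d, i' d}`, whose `j`-th
leg is indexed by the pairs `(i j, i' j)`. -/
def rankOne {d : ℕ} {N : Fin d → ℕ} (g g' : (∀ j, Fin (N j)) → ℂ) :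
    (∀ j, Fin (N j) × Fin (N j)) → ℂ :=
  fun p => g (fun j => (p j).1) * g' (fun j => (p j).2)

/-- `v` is an orthogonal basis, formed of unitary matrices, of the space of `N × N` complex matrices
with the Hilbert-Schmidt inner product. (Being `N²` nonzero pairwise orthogonal vectors, the `v k`
do form a basis.) -/
def IsUnitaryBasis {N : ℕ} (v : Fin (N ^ 2) → Matrix (Fin N) (Fin N) ℂ) : Prop :=
  (∀ k, v k ∈ Matrix.unitaryGroup (Fin N) ℂ) ∧
    ∀ k l, k ≠ l → ((v k).conjTranspose * v l).trace = 0

/-- The coefficients `(N 1 ⋯ N d)⁻¹ ⟨T, v₁ (i 1) ⊗ ⋯ ⊗ v_d (i d)⟩` of `T` in the orthogonal basis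
`v₁ (i 1) ⊗ ⋯ ⊗ v_d (i d)`; they are also the coefficients, in the canonical basis, of the
associated element `t` of `ℓ₁^{(N 1)²} ⊗ ⋯ ⊗ ℓ₁^{(N d)²}`. -/
def basisCoeff {d : ℕ} {N : Fin d → ℕ} (v : ∀ j, Fin (N j ^ 2) → Matrix (Fin (N j)) (Fin (N j)) ℂ)
    (T : (∀ j, Fin (N j) × Fin (N j)) → ℂ) : (∀ j, Fin (N j ^ 2)) → ℂ :=
  fun i => (∏ j, (N j : ℂ))⁻¹ *
    ∑ p, T p * ∏ j, (starRingEnd ℂ) (v j (i j) (p j).1 (p j).2)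

/-- The law of a pair of independent families of i.i.d. standard normal real random variables, each
indexed by the finite set `ι`. -/
def gaussianPair (ι : Type) [Fintype ι] : MeasureTheory.Measure ((ι → ℝ) × (ι → ℝ)) :=
  (MeasureTheory.Measure.pi fun _ : ι => ProbabilityTheory.gaussianReal 0 1).prod
    (MeasureTheory.Measure.pi fun _ : ι => ProbabilityTheory.gaussianReal 0 1)

/-- The random tensor `T`: the tensor `rankOne g g'` built from a pair of real arrays. -/
def realRankOne {d : ℕ} {N : Fin d → ℕ}
    (ω : ((∀ j, Fin (N j)) → ℝ) × ((∀ j, Fin (N j)) → ℝ)) :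
    (∀ j, Fin (N j) × Fin (N j)) → ℂ :=
  rankOne (fun i => (ω.1 i : ℂ)) (fun i => (ω.2 i : ℂ))

end BellTensor

end

/-! Lower bound for the minimal norm. Let the basis matrices act on separate blocks of one Hilbert
space. The coefficients of `T` in the unitary bases then recombine, on the product of the blocks, to
the matrix with entries `g a * g' b`. This has rank one and norm `‖g‖₂‖g'‖₂`
(`l2Norm_mul_le_minNorm`).

Upper bound for the injective norm. By orthogonality, expanding a unimodular family of length `N j ^
2` in the conjugate basis gives a vector of `ℓ₂`-norm exactly `√(N j)`. Each leg therefore costs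
`√(N j)` (`injNorm_basisCoeff_le`). Dividing the two bounds, with a Weyl basis, gives the inequality
for `bellConst`.

Gaussian case. The norm of `T` is the supremum of `|g · (X₁ ⊗ ⋯ ⊗ X_d) g'|` over matrices in
Hilbert–Schmidt balls. A net of these balls alone is too large, so each `X_j` is replaced by
normalized products `A Bᵀ / √r` of contractions supported on `r` columns. If a linear form is
bounded by `K` on all of these, its largest singular values satisfy `c₁ + ⋯ + c_r ≤ K√r`, and hence
`∑ c_m² ≤ K² (1 + 1/2 + ⋯ + 1/N)`. Each leg loses only `√(log N)`
(`sum_norm_sq_le_of_partial_isometries`, `injNormHilbert_rankOne_le`).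

For fixed ranks `r_j` the variables are treated one after the other. First, `‖(B₁ ⊗ ⋯ ⊗ B_d)ᵀ g'‖`
is at most a constant times `√L`, uniformly in `B`, where `L = N ∏ r_j` omits the largest rank; the
leg of that rank is a contraction and can be discarded (`measure_transpose_mulVec_le`).
Conditionally on `g'`, a net of dimension of order `N · max r_j` then gives `√L · √(N max r_j) = N
√(∏ r_j)` (`gaussianPair_form_le`). The failure probabilities beat the number of supports. A small
ball estimate bounds `‖g‖₂` and `‖g'‖₂` from below. -/

noncomputable section

namespace BellTensor

/-! ### Elementary tensors in the Hilbert tensor power -/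

section PureTensor

variable {H : Type} [NormedAddCommGroup H] [InnerProductSpace ℂ H]

/-- The elementary tensor `x₁ ⊗ ⋯ ⊗ x_d`. -/
def pureTensor : (d : ℕ) → (Fin d → H) → (algTensorPower H d).carrier
  | 0, _ => (1 : ℂ)
  | d + 1, x => (x 0 ⊗ₜ[ℂ] pureTensor d (Fin.tail x) : H ⊗[ℂ] (algTensorPower H d).carrier)

theorem inner_pureTensor : ∀ (d : ℕ) (x y : Fin d → H),
    inner ℂ (pureTensor d x) (pureTensor d y) = ∏ j, inner ℂ (x j) (y j)
  | 0, x, y => by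
    change inner ℂ (1 : ℂ) (1 : ℂ) = _
    simp
  | d + 1, x, y => by
    change inner ℂ (x 0 ⊗ₜ[ℂ] pureTensor d (Fin.tail x)) (y 0 ⊗ₜ[ℂ] pureTensor d (Fin.tail y)) = _
    rw [TensorProduct.inner_tmul, inner_pureTensor d, Fin.prod_univ_succ]
    rfl

theorem algTensorOp_pureTensor : ∀ (d : ℕ) (u : Fin d → (H ≃ₗᵢ[ℂ] H)) (x : Fin d → H),
    algTensorOp d u (pureTensor d x) = pureTensor d (fun j => u j (x j))
  | 0, u, x => rfl
  | d + 1, u, x => by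
    change TensorProduct.mapIsometry (u 0).toLinearIsometry (algTensorOp d (Fin.tail u))
      (x 0 ⊗ₜ[ℂ] pureTensor d (Fin.tail x)) = _
    rw [TensorProduct.mapIsometry_apply, TensorProduct.map_tmul]
    change (u 0 (x 0)) ⊗ₜ[ℂ] (algTensorOp d (Fin.tail u) (pureTensor d (Fin.tail x))) = _
    rw [algTensorOp_pureTensor d]
    rfl

theorem norm_tensorOp_le_one {d : ℕ} (u : Fin d → (H ≃ₗᵢ[ℂ] H)) : ‖tensorOp u‖ ≤ 1 := by
  refine ContinuousLinearMap.opNorm_le_bound _ zero_le_one fun x => ?_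
  rw [one_mul]
  refine UniformSpace.Completion.induction_on x
    (isClosed_le (by fun_prop) (by fun_prop)) fun a => ?_
  rw [tensorOp, ContinuousLinearMap.completion_apply_coe]
  simp

theorem inner_tensorOp_pureTensor {d : ℕ} (u : Fin d → (H ≃ₗᵢ[ℂ] H)) (x y : Fin d → H) :
    inner ℂ (pureTensor d y : HilbertTensorPower H d)
      (tensorOp u (pureTensor d x : HilbertTensorPower H d)) = ∏ j, inner ℂ (y j) (u j (x j)) := by
  rw [tensorOp, ContinuousLinearMap.completion_apply_coe, UniformSpace.Completion.inner_coe,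
    LinearIsometry.coe_toContinuousLinearMap, algTensorOp_pureTensor, inner_pureTensor]

theorem inner_coe_pureTensor {d : ℕ} (x y : Fin d → H) :
    inner ℂ (pureTensor d y : HilbertTensorPower H d) (pureTensor d x : HilbertTensorPower H d)
      = ∏ j, inner ℂ (y j) (x j) := by
  rw [UniformSpace.Completion.inner_coe, inner_pureTensor]

end PureTensor

/-! ### The minimal norm as a genuine supremum -/

section MinNorm

variable {d : ℕ} {n : Fin d → ℕ}

/-- Tensor products of unitaries have norm at most one, so the triangle inequality suffices.
Boundedness matters because a real `sSup` of an unbounded set is `0` by default. -/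
theorem bddAbove_minNorm (t : (∀ j, Fin (n j)) → ℂ) :
    BddAbove {r : ℝ | ∃ (H : Type) (_ : NormedAddCommGroup H) (_ : InnerProductSpace ℂ H)
      (_ : CompleteSpace H) (u : ∀ j, Fin (n j) → (H ≃ₗᵢ[ℂ] H)),
      r = ‖∑ i : (∀ j, Fin (n j)), t i • tensorOp (fun j => u j (i j))‖} ∧
    minNorm t ≤ ∑ i, ‖t i‖ := by
  have key : ∀ r ∈ {r : ℝ | ∃ (H : Type) (_ : NormedAddCommGroup H) (_ : InnerProductSpace ℂ H)
      (_ : CompleteSpace H) (u : ∀ j, Fin (n j) → (H ≃ₗᵢ[ℂ] H)),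
      r = ‖∑ i : (∀ j, Fin (n j)), t i • tensorOp (fun j => u j (i j))‖}, r ≤ ∑ i, ‖t i‖ := by
    rintro r ⟨H, _, _, _, u, rfl⟩
    refine (norm_sum_le _ _).trans (Finset.sum_le_sum fun i _ => ?_)
    rw [norm_smul]
    exact mul_le_of_le_one_right (norm_nonneg _) (norm_tensorOp_le_one _)
  exact ⟨⟨_, key⟩, Real.sSup_le key (Finset.sum_nonneg fun _ _ => norm_nonneg _)⟩

theorem le_minNorm (t : (∀ j, Fin (n j)) → ℂ) {H : Type} [NormedAddCommGroup H]
    [InnerProductSpace ℂ H] [CompleteSpace H] (u : ∀ j, Fin (n j) → (H ≃ₗᵢ[ℂ] H)) :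
    ‖∑ i : (∀ j, Fin (n j)), t i • tensorOp (fun j => u j (i j))‖ ≤ minNorm t :=
  le_csSup (bddAbove_minNorm t).1 ⟨H, _, _, ‹_›, u, rfl⟩

theorem minNorm_nonneg (t : (∀ j, Fin (n j)) → ℂ) : 0 ≤ minNorm t :=
  Real.sSup_nonneg (by rintro r ⟨H, _, _, _, u, rfl⟩; exact norm_nonneg _)

theorem minNorm_smul {a : ℝ} (ha : 0 ≤ a) (t : (∀ j, Fin (n j)) → ℂ) :
    minNorm (fun i => (a : ℂ) * t i) = a * minNorm t := by
  rw [minNorm, minNorm, ← smul_eq_mul a, ← Real.sSup_smul_of_nonneg ha]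
  congr 1
  ext r
  have key : ∀ (H : Type) [NormedAddCommGroup H] [InnerProductSpace ℂ H] [CompleteSpace H]
      (u : ∀ j, Fin (n j) → (H ≃ₗᵢ[ℂ] H)),
      ‖∑ i : (∀ j, Fin (n j)), ((a : ℂ) * t i) • tensorOp (fun j => u j (i j))‖ =
        a * ‖∑ i : (∀ j, Fin (n j)), t i • tensorOp (fun j => u j (i j))‖ := by
    intro H _ _ _ u
    simp_rw [mul_smul, ← Finset.smul_sum, norm_smul]
    simp [abs_of_nonneg ha]
  simp only [Set.mem_smul_set, Set.mem_ofPred_eq]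
  constructor
  · rintro ⟨H, _, _, _, u, rfl⟩
    exact ⟨_, ⟨H, _, _, ‹_›, u, rfl⟩, (key H u).symm⟩
  · rintro ⟨_, ⟨H, _, _, _, u, rfl⟩, rfl⟩
    exact ⟨H, _, _, ‹_›, u, (key H u).symm⟩

end MinNorm

/-! ### Changing the test sets of a multilinear form leg by leg -/

section Multilinear

/-- A multilinear form that is bounded on a product of sets `P j` is bounded on a product of sets
`Q j` as soon as bounds for linear forms pass, up to a constant, from each `P j` to `Q j`. -/
theorem norm_le_of_forall_legs {ι : Type*} [Fintype ι] {E : ι → Type*}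
    [∀ j, AddCommMonoid (E j)] [∀ j, Module ℂ (E j)] (Φ : MultilinearMap ℂ E ℂ)
    (P Q : ∀ j, Set (E j)) {c M : ℝ}
    (h : ∀ j (l : E j →ₗ[ℂ] ℂ) (M : ℝ), (∀ p ∈ P j, ‖l p‖ ≤ M) → ∀ q ∈ Q j, ‖l q‖ ≤ c * M)
    (hP : ∀ x, (∀ j, x j ∈ P j) → ‖Φ x‖ ≤ M) {x : ∀ j, E j} (hx : ∀ j, x j ∈ Q j) :
    ‖Φ x‖ ≤ c ^ Fintype.card ι * M := by
  classical
  -- The legs in `s` have already been moved to `Q`. Moving leg `a` as well costs one factor `c`,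
  -- since the form is linear in that leg once the others are frozen.
  have key : ∀ s : Finset ι, ∀ x : ∀ j, E j, (∀ j ∈ s, x j ∈ Q j) → (∀ j ∉ s, x j ∈ P j) →
      ‖Φ x‖ ≤ c ^ s.card * M := by
    intro s
    induction s using Finset.induction_on with
    | empty => exact fun x _ hx => by simpa using hP x fun j => hx j (Finset.notMem_empty j)
    | insert a s ha ih =>
      intro x hQ hP'
      have := h a (Φ.toLinearMap x a) (c ^ s.card * M) (fun p hp => ?_) (x a)
        (hQ a (Finset.mem_insert_self _ _))
      · rw [MultilinearMap.toLinearMap_apply, Function.update_eq_self] at this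
        rw [Finset.card_insert_of_notMem ha, pow_succ']
        linarith
      · refine ih _ (fun j hj => ?_) fun j hj => ?_
        · rw [Function.update_of_ne (by rintro rfl; exact ha hj)]
          exact hQ j (Finset.mem_insert_of_mem hj)
        · by_cases hja : j = a
          · subst hja
            simpa using hp
          · rw [Function.update_of_ne hja]
            exact hP' j (by simp [hj, hja])
  exact key Finset.univ x (fun j _ => hx j) (by simp)

/-- The multilinear form `x ↦ ∑ i, t i * x₁ (i 1) * ⋯ * x_d (i d)`. -/
def multiformMap {d : ℕ} {ι : Fin d → Type} [∀ j, Fintype (ι j)] (t : (∀ j, ι j) → ℂ) :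
    MultilinearMap ℂ (fun j => ι j → ℂ) ℂ :=
  ∑ i, t i • (MultilinearMap.mkPiAlgebra ℂ (Fin d) ℂ).compLinearMap
    fun j => LinearMap.proj (i j)

theorem multiformMap_apply {d : ℕ} {ι : Fin d → Type} [∀ j, Fintype (ι j)] (t : (∀ j, ι j) → ℂ)
    (x : ∀ j, ι j → ℂ) : multiformMap t x = multiform t x := by
  simp [multiformMap, multiform]

end Multilinear

/-! ### Injective norms and the Bell constant -/

section InjNorm

variable {d : ℕ} {n : Fin d → ℕ}

theorem norm_multiform_le {ι : Fin d → Type} [∀ j, Fintype (ι j)]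
    (t : (∀ j, ι j) → ℂ) (x : ∀ j, ι j → ℂ) (hx : ∀ j k, ‖x j k‖ ≤ 1) :
    ‖multiform t x‖ ≤ ∑ i, ‖t i‖ := by
  refine (norm_sum_le _ _).trans (Finset.sum_le_sum fun i _ => ?_)
  rw [norm_mul, norm_prod]
  exact mul_le_of_le_one_right (norm_nonneg _)
    (Finset.prod_le_one (fun _ _ => norm_nonneg _) fun j _ => hx j _)

theorem norm_multiform_le_injNorm (t : (∀ j, Fin (n j)) → ℂ) (x : ∀ j, Fin (n j) → ℂ)
    (hx : ∀ j k, ‖x j k‖ = 1) : ‖multiform t x‖ ≤ injNorm t := by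
  refine le_csSup ⟨∑ i, ‖t i‖, ?_⟩ ⟨x, hx, rfl⟩
  rintro r ⟨x, hx, rfl⟩
  exact norm_multiform_le t x fun j k => (hx j k).le

theorem injNorm_le {t : (∀ j, Fin (n j)) → ℂ} {M : ℝ} (hM : 0 ≤ M)
    (h : ∀ x : ∀ j, Fin (n j) → ℂ, (∀ j k, ‖x j k‖ = 1) → ‖multiform t x‖ ≤ M) :
    injNorm t ≤ M :=
  Real.sSup_le (by rintro r ⟨x, hx, rfl⟩; exact h x hx) hM

theorem multiform_mul_left {ι : Fin d → Type} [∀ j, Fintype (ι j)] (a : ℂ)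
    (t : (∀ j, ι j) → ℂ) (x : ∀ j, ι j → ℂ) :
    multiform (fun i => a * t i) x = a * multiform t x := by
  simp [multiform, Finset.mul_sum, mul_assoc]

theorem norm_multiform_le_injNormHilbert {ι : Fin d → Type} [∀ j, Fintype (ι j)]
    (T : (∀ j, ι j) → ℂ) (x : ∀ j, EuclideanSpace ℂ (ι j)) (hx : ∀ j, ‖x j‖ ≤ 1) :
    ‖multiform T (fun j k => x j k)‖ ≤ injNormHilbert T := by
  refine le_csSup ⟨∑ i, ‖T i‖, ?_⟩ ⟨x, hx, rfl⟩
  rintro r ⟨x, hx, rfl⟩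
  exact norm_multiform_le T _ fun j k => (PiLp.norm_apply_le (x j) k).trans (hx j)

theorem injNormHilbert_nonneg {ι : Fin d → Type} [∀ j, Fintype (ι j)]
    (T : (∀ j, ι j) → ℂ) : 0 ≤ injNormHilbert T :=
  Real.sSup_nonneg (by rintro r ⟨x, _, rfl⟩; exact norm_nonneg _)

/-- The coefficients of a tensor are bounded by its injective norm. -/
theorem norm_apply_le_injNorm (t : (∀ j, Fin (n j)) → ℂ) (i : ∀ j, Fin (n j)) :
    ‖t i‖ ≤ injNorm t := by
  classical
  have h1 : t i = multiformMap t (fun j => Pi.single (i j) 1) := by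
    rw [multiformMap_apply, multiform, Finset.sum_eq_single i]
    · simp
    · intro k _ hk
      obtain ⟨j, hj⟩ : ∃ j, k j ≠ i j := by
        by_contra! h
        exact hk (funext h)
      rw [Finset.prod_eq_zero (Finset.mem_univ j) (by simp [hj]), mul_zero]
    · simp
  rw [h1]
  refine (norm_le_of_forall_legs (c := 1) (multiformMap t)
    (fun j => {x : Fin (n j) → ℂ | ∀ k, ‖x k‖ = 1}) (fun j => {Pi.single (i j) 1}) (M := injNorm t)
    ?_ ?_ (x := fun j => Pi.single (i j) 1) fun j => rfl).trans (by simp)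
  · rintro j l M hM _ rfl
    -- A coordinate vector is half the difference of two unimodular vectors, so no constant is lost.
    have h2 : (Pi.single (i j) 1 : Fin (n j) → ℂ) =
        (2⁻¹ : ℂ) • ((fun _ => 1) - fun k => if k = i j then -1 else 1) := by
      ext k
      by_cases hk : k = i j
      · subst hk; simp; norm_num
      · simp [hk]
    rw [h2, map_smul, map_sub, norm_smul]
    have h3 := hM (fun _ => 1) (by simp)
    have h4 := hM (fun k => if k = i j then -1 else 1) (fun k => by dsimp only; split_ifs <;> simp)
    have h5 := norm_sub_le (l fun _ => 1) (l fun k => if k = i j then -1 else 1)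
    norm_num
    linarith
  · exact fun x hx => by simpa only [multiformMap_apply] using norm_multiform_le_injNorm t x hx

/-- By homogeneity `t / A` is admissible in the supremum. That supremum is finite because the
injective norm dominates every coefficient, which bounds the minimal norm by the number of
coefficients. -/
theorem minNorm_div_le_bellConst {t : (∀ j, Fin (n j)) → ℂ} {A : ℝ} (hA : 0 < A)
    (h : injNorm t ≤ A) : minNorm t / A ≤ bellConst n := by
  refine le_csSup ⟨∑ _i : (∀ j, Fin (n j)), 1, ?_⟩
    ⟨fun i => ((A⁻¹ : ℝ) : ℂ) * t i, ?_, ?_⟩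
  · rintro _ ⟨t, ht, rfl⟩
    exact (bddAbove_minNorm t).2.trans
      (Finset.sum_le_sum fun i _ => (norm_apply_le_injNorm t i).trans ht)
  · refine injNorm_le zero_le_one fun x hx => ?_
    rw [multiform_mul_left, norm_mul, Complex.norm_real, Real.norm_of_nonneg (inv_nonneg.2 hA.le),
      inv_mul_le_one₀ hA]
    exact (norm_multiform_le_injNorm t x hx).trans h
  · rw [minNorm_smul (inv_nonneg.2 hA.le), div_eq_inv_mul]

theorem bellConst_nonneg (n : Fin d → ℕ) : 0 ≤ bellConst n :=
  Real.sSup_nonneg (by rintro r ⟨t, _, rfl⟩; exact minNorm_nonneg t)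

end InjNorm

/-! ### Orthogonality relations of a unitary basis -/

section UnitaryBasis

variable {N : ℕ} {v : Fin (N ^ 2) → Matrix (Fin N) (Fin N) ℂ}

theorem IsUnitaryBasis.sum_mul_conj (hv : IsUnitaryBasis v) (k l : Fin (N ^ 2)) :
    ∑ p : Fin N × Fin N, v k p.1 p.2 * (starRingEnd ℂ) (v l p.1 p.2) =
      if k = l then (N : ℂ) else 0 := by
  have h : ∑ p : Fin N × Fin N, v k p.1 p.2 * (starRingEnd ℂ) (v l p.1 p.2) =
      ((v l).conjTranspose * v k).trace := by
    simp only [Matrix.trace, Matrix.diag, Matrix.mul_apply, Fintype.sum_prod_type,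
      Matrix.conjTranspose_apply]
    rw [Finset.sum_comm]
    simp [mul_comm]
  rw [h]
  split_ifs with hkl
  · subst hkl
    have := (Matrix.mem_unitaryGroup_iff'.1 (hv.1 k))
    rw [Matrix.star_eq_conjTranspose] at this
    simp [this]
  · exact hv.2 l k (Ne.symm hkl)

/-- The `N²` orthogonal matrices are the rows of a square matrix of size `N²`. A right inverse of it
is also a left inverse, which turns orthogonality of rows into completeness. -/
theorem IsUnitaryBasis.sum_conj_mul (hN : 1 ≤ N) (hv : IsUnitaryBasis v) (p q : Fin N × Fin N) :
    ∑ k, (N : ℂ)⁻¹ * ((starRingEnd ℂ) (v k p.1 p.2) * v k q.1 q.2) = if p = q then 1 else 0 := by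
  have hN' : (N : ℂ) ≠ 0 := by exact_mod_cast (by omega : N ≠ 0)
  let V : Matrix (Fin (N ^ 2)) (Fin N × Fin N) ℂ := Matrix.of fun k p => v k p.1 p.2
  have h1 : V * ((N : ℂ)⁻¹ • V.conjTranspose) = 1 := by
    ext k l
    rw [Matrix.mul_smul, Matrix.smul_apply, Matrix.mul_apply]
    simp only [Matrix.conjTranspose_apply, V, Matrix.of_apply]
    have := hv.sum_mul_conj k l
    simp only [starRingEnd_apply] at this
    rw [this, Matrix.one_apply]
    split_ifs <;> simp [hN']
  have h2 := (Matrix.mul_eq_one_comm_of_card_eq _ _ _ (by simp [sq])).1 h1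
  have h3 := congrFun (congrFun h2 p) q
  rw [Matrix.mul_apply, Matrix.one_apply] at h3
  rw [← h3]
  refine Finset.sum_congr rfl fun k _ => ?_
  simp [V, mul_assoc]

/-- The array with coefficients `x` in the basis of the conjugates of the `v k`. -/
def conjExpand (v : Fin (N ^ 2) → Matrix (Fin N) (Fin N) ℂ) (x : Fin (N ^ 2) → ℂ) :
    Fin N × Fin N → ℂ :=
  fun p => ∑ k, (N : ℂ)⁻¹ * ((starRingEnd ℂ) (v k p.1 p.2) * x k)

theorem IsUnitaryBasis.sum_norm_sq_conjExpand (hN : 1 ≤ N) (hv : IsUnitaryBasis v)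
    (x : Fin (N ^ 2) → ℂ) :
    (N : ℝ) * ∑ p, ‖conjExpand v x p‖ ^ 2 = ∑ k, ‖x k‖ ^ 2 := by
  have hN' : (N : ℂ) ≠ 0 := by exact_mod_cast (by omega : N ≠ 0)
  have h : ((N : ℝ) * ∑ p, ‖conjExpand v x p‖ ^ 2 : ℂ) = ∑ k, (‖x k‖ : ℂ) ^ 2 := by
    push_cast
    simp_rw [← Complex.mul_conj']
    calc ((N : ℝ) : ℂ) * ∑ p, conjExpand v x p * (starRingEnd ℂ) (conjExpand v x p)
        = N * ∑ p : Fin N × Fin N, ∑ k, ∑ l, (N : ℂ)⁻¹ * (N : ℂ)⁻¹ * (x k * (starRingEnd ℂ) (x l)) *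
            (v l p.1 p.2 * (starRingEnd ℂ) (v k p.1 p.2)) := by
          congr 1
          refine Finset.sum_congr rfl fun p _ => ?_
          rw [conjExpand, map_sum, Finset.sum_mul_sum]
          refine Finset.sum_congr rfl fun k _ => Finset.sum_congr rfl fun l _ => ?_
          simp
          ring
      _ = N * ∑ k, ∑ l, (N : ℂ)⁻¹ * (N : ℂ)⁻¹ * (x k * (starRingEnd ℂ) (x l)) *
            if l = k then (N : ℂ) else 0 := by
          congr 1
          rw [Finset.sum_comm]
          refine Finset.sum_congr rfl fun k _ => ?_
          rw [Finset.sum_comm]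
          refine Finset.sum_congr rfl fun l _ => ?_
          rw [← Finset.mul_sum, hv.sum_mul_conj]
      _ = ∑ k, x k * (starRingEnd ℂ) (x k) := by
          rw [Finset.mul_sum]
          refine Finset.sum_congr rfl fun k _ => ?_
          simp
          field_simp
  exact_mod_cast h

end UnitaryBasis

/-! ### Passing between the tensor and its coefficients -/

section Coefficients

variable {d : ℕ} {N : Fin d → ℕ} {v : ∀ j, Fin (N j ^ 2) → Matrix (Fin (N j)) (Fin (N j)) ℂ}

theorem multiform_basisCoeff (T : (∀ j, Fin (N j) × Fin (N j)) → ℂ) (x : ∀ j, Fin (N j ^ 2) → ℂ) :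
    multiform (basisCoeff v T) x = multiform T (fun j => conjExpand (v j) (x j)) := by
  simp only [multiform, basisCoeff, conjExpand]
  simp_rw [Finset.prod_univ_sum, Fintype.piFinset_univ, Finset.mul_sum, Finset.sum_mul]
  rw [Finset.sum_comm]
  refine Finset.sum_congr rfl fun p _ => Finset.sum_congr rfl fun i _ => ?_
  rw [Finset.prod_mul_distrib, Finset.prod_mul_distrib, Finset.prod_inv_distrib]
  ring

/-- The inversion formula: completeness makes the entries of the basis matrices reproduce the
tensor. -/
theorem multiform_basisCoeff_entries (hN : ∀ j, 1 ≤ N j) (hv : ∀ j, IsUnitaryBasis (v j))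
    (T : (∀ j, Fin (N j) × Fin (N j)) → ℂ) (q : ∀ j, Fin (N j) × Fin (N j)) :
    multiform (basisCoeff v T) (fun j k => v j k (q j).1 (q j).2) = T q := by
  rw [multiform_basisCoeff, multiform, Finset.sum_eq_single q]
  · simp [conjExpand, (hv _).sum_conj_mul (hN _)]
  · intro p _ hp
    obtain ⟨j, hj⟩ : ∃ j, p j ≠ q j := by
      by_contra! h
      exact hp (funext h)
    rw [Finset.prod_eq_zero (Finset.mem_univ j), mul_zero]
    rw [conjExpand, (hv _).sum_conj_mul (hN _), if_neg hj]
  · simp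

/-- A unimodular `x j` has squared norm `N j ^ 2`, so its expansion has squared norm `N j`. Dividing
each leg by `√(N j)` puts it in the unit ball. -/
theorem injNorm_basisCoeff_le (hN : ∀ j, 1 ≤ N j) (hv : ∀ j, IsUnitaryBasis (v j))
    (T : (∀ j, Fin (N j) × Fin (N j)) → ℂ) :
    injNorm (basisCoeff v T) ≤ (∏ j, (N j : ℝ)) ^ (1 / 2 : ℝ) * injNormHilbert T := by
  have hN0 : ∀ j, (0 : ℝ) < N j := fun j => by exact_mod_cast hN j
  refine injNorm_le (mul_nonneg (by positivity) (injNormHilbert_nonneg T)) fun x hx => ?_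
  rw [← Real.sqrt_eq_rpow, Real.sqrt_prod _ fun _ _ => Nat.cast_nonneg _]
  have h1 : multiform (basisCoeff v T) x = (∏ j, (√(N j : ℝ) : ℂ)) *
      multiform T (fun j p => (√(N j : ℝ) : ℂ)⁻¹ * conjExpand (v j) (x j) p) := by
    rw [multiform_basisCoeff]
    simp only [multiform, Finset.mul_sum, Finset.prod_mul_distrib]
    refine Finset.sum_congr rfl fun p _ => ?_
    have : (∏ j, (√(N j : ℝ) : ℂ)) * ∏ j, (√(N j : ℝ) : ℂ)⁻¹ = 1 := by
      rw [← Finset.prod_mul_distrib]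
      refine Finset.prod_eq_one fun j _ => mul_inv_cancel₀ ?_
      exact_mod_cast (Real.sqrt_pos.2 (hN0 j)).ne'
    linear_combination (-(T p * ∏ j, conjExpand (v j) (x j) (p j))) * this
  rw [h1, norm_mul, norm_prod]
  simp_rw [Complex.norm_real, Real.norm_of_nonneg (Real.sqrt_nonneg _)]
  refine mul_le_mul_of_nonneg_left ?_ (by positivity)
  refine norm_multiform_le_injNormHilbert T (fun j => WithLp.toLp 2
    (fun p => (√(N j : ℝ) : ℂ)⁻¹ * conjExpand (v j) (x j) p)) fun j => ?_
  rw [EuclideanSpace.norm_eq]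
  refine Real.sqrt_le_one.2 ?_
  have h2 := (hv j).sum_norm_sq_conjExpand (hN j) (x j)
  simp only [hx, one_pow, Finset.sum_const, Finset.card_univ, Fintype.card_fin, nsmul_eq_mul,
    mul_one, Nat.cast_pow] at h2
  have h3 : ∑ p, ‖conjExpand (v j) (x j) p‖ ^ 2 = N j := by
    have := (hN0 j).ne'
    field_simp at h2
    linarith
  simp_rw [norm_mul, mul_pow, ← Finset.mul_sum, h3, norm_inv, Complex.norm_real,
    Real.norm_of_nonneg (Real.sqrt_nonneg _), inv_pow, Real.sq_sqrt (hN0 j).le]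
  rw [inv_mul_cancel₀ (hN0 j).ne']

end Coefficients

/-! ### Lower bound for the minimal norm -/

section LowerBound

variable {ι : Type} [Fintype ι] [DecidableEq ι]

/-- The unitary operator on `ℓ₂(ι)` with a given unitary matrix. -/
def unitaryOp (M : Matrix.unitaryGroup ι ℂ) :
    EuclideanSpace ℂ ι ≃ₗᵢ[ℂ] EuclideanSpace ℂ ι :=
  Unitary.linearIsometryEquiv
    ⟨Matrix.toEuclideanCLM (n := ι) (𝕜 := ℂ) M.1, Unitary.map_mem _ M.2⟩

theorem inner_unitaryOp_single (M : Matrix.unitaryGroup ι ℂ) (a b : ι) :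
    inner ℂ (EuclideanSpace.single a (1 : ℂ)) (unitaryOp M (EuclideanSpace.single b 1)) =
      M.1 a b := by
  have : unitaryOp M (EuclideanSpace.single b 1) =
    Matrix.toEuclideanCLM (n := ι) (𝕜 := ℂ) M.1 (EuclideanSpace.single b 1) := rfl
  rw [this, EuclideanSpace.inner_single_left]
  simp [Matrix.ofLp_toEuclideanCLM]

variable {d : ℕ} {N : Fin d → ℕ}

/-- The unitary matrix with a given block at the place `j`, and identity blocks elsewhere. -/
def blockUnitary (j : Fin d) (M : Matrix.unitaryGroup (Fin (N j)) ℂ) :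
    Matrix.unitaryGroup (Σ j, Fin (N j)) ℂ :=
  ⟨Matrix.blockDiagonal' (Function.update (fun _ => 1) j M.1), by
    rw [Matrix.mem_unitaryGroup_iff, Matrix.star_eq_conjTranspose,
      Matrix.blockDiagonal'_conjTranspose, ← Matrix.blockDiagonal'_mul, ← Matrix.blockDiagonal'_one]
    congr 1
    ext k : 1
    by_cases hk : k = j
    · subst hk
      simpa [Matrix.star_eq_conjTranspose] using Matrix.mem_unitaryGroup_iff.1 M.2
    · simp [Function.update_of_ne hk]⟩

theorem blockUnitary_apply (j : Fin d) (M : Matrix.unitaryGroup (Fin (N j)) ℂ) (a b : Fin (N j)) :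
    (blockUnitary j M).1 ⟨j, a⟩ ⟨j, b⟩ = M.1 a b := by
  simp [blockUnitary, Matrix.blockDiagonal'_apply_eq]

variable {v : ∀ j, Fin (N j ^ 2) → Matrix (Fin (N j)) (Fin (N j)) ℂ}

/-- On the product of the blocks the operator is the rank one matrix `g a * g' b`. Testing it on `g`
and the conjugate of `g'` gives the product of the norms. -/
theorem l2Norm_mul_le_minNorm (hN : ∀ j, 1 ≤ N j) (hv : ∀ j, IsUnitaryBasis (v j))
    (g g' : (∀ j, Fin (N j)) → ℂ) :
    l2Norm g * l2Norm g' ≤ minNorm (basisCoeff v (rankOne g g')) := by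
  -- The dimensions `N j` may differ while the minimal norm asks for one common space, so leg `j`
  -- acts on the `j`th block of a direct sum.
  let u : ∀ j, Fin (N j ^ 2) →
      (EuclideanSpace ℂ (Σ j, Fin (N j)) ≃ₗᵢ[ℂ] EuclideanSpace ℂ (Σ j, Fin (N j))) :=
    fun j k => unitaryOp (blockUnitary j ⟨v j k, (hv j).1 k⟩)
  refine le_trans ?_ (le_minNorm _ u)
  set A := ∑ i : (∀ j, Fin (N j ^ 2)),
    basisCoeff v (rankOne g g') i • tensorOp (fun j => u j (i j)) with hA
  let e : (∀ j, Fin (N j)) → HilbertTensorPower (EuclideanSpace ℂ (Σ j, Fin (N j))) d := fun i =>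
    (pureTensor d fun j => EuclideanSpace.single ⟨j, i j⟩ (1 : ℂ) :
      (algTensorPower (EuclideanSpace ℂ (Σ j, Fin (N j))) d).carrier)
  have he : ∀ a b, inner ℂ (e a) (e b) = if a = b then (1 : ℂ) else 0 := by
    intro a b
    simp only [e]
    rw [inner_coe_pureTensor]
    split_ifs with hab
    · subst hab
      simp
    · obtain ⟨j, hj⟩ : ∃ j, a j ≠ b j := by
        by_contra! h
        exact hab (funext h)
      refine Finset.prod_eq_zero (Finset.mem_univ j) ?_
      simp [EuclideanSpace.inner_single_left, hj]
  have hsum : ∀ f : (∀ j, Fin (N j)) → ℂ, ‖∑ i, f i • e i‖ = l2Norm f := by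
    intro f
    rw [l2Norm, ← Real.sqrt_sq (norm_nonneg (∑ i, f i • e i))]
    congr 1
    have : ((‖∑ i, f i • e i‖ ^ 2 : ℝ) : ℂ) = ((∑ i, ‖f i‖ ^ 2 : ℝ) : ℂ) := by
      push_cast
      refine (inner_self_eq_norm_sq_to_K (𝕜 := ℂ) (∑ i, f i • e i)).symm.trans ?_
      simp only [sum_inner, inner_sum, inner_smul_left, inner_smul_right, he]
      simp [← Complex.mul_conj']
    exact_mod_cast this
  have hAe : ∀ a b, inner ℂ (e a) (A (e b)) = g a * g' b := by
    intro a b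
    simp only [hA, sum_apply, smul_apply, inner_sum,
      inner_smul_right, e, inner_tensorOp_pureTensor, u, inner_unitaryOp_single, blockUnitary_apply]
    exact multiform_basisCoeff_entries hN hv (rankOne g g') (fun j => (a j, b j))
  have hin : inner ℂ (∑ a, g a • e a) (A (∑ b, (starRingEnd ℂ) (g' b) • e b)) =
      ((l2Norm g ^ 2 * l2Norm g' ^ 2 : ℝ) : ℂ) := by
    rw [l2Norm, l2Norm, Real.sq_sqrt (by positivity), Real.sq_sqrt (by positivity)]
    simp only [map_sum, map_smul, sum_inner, inner_sum, inner_smul_left, inner_smul_right, hAe,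
      Finset.mul_sum]
    push_cast
    refine Finset.sum_congr rfl fun b _ => ?_
    rw [Finset.sum_mul]
    refine Finset.sum_congr rfl fun a _ => ?_
    rw [← Complex.conj_mul', ← Complex.conj_mul']
    ring
  have hle : l2Norm g ^ 2 * l2Norm g' ^ 2 ≤ l2Norm g * (‖A‖ * l2Norm g') := by
    have h1 : l2Norm g ^ 2 * l2Norm g' ^ 2 =
        ‖inner ℂ (∑ a, g a • e a) (A (∑ b, (starRingEnd ℂ) (g' b) • e b))‖ := by
      rw [hin, Complex.norm_real, Real.norm_of_nonneg (by positivity)]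
    rw [h1]
    refine (norm_inner_le_norm _ _).trans ?_
    rw [hsum]
    refine mul_le_mul_of_nonneg_left ((A.le_opNorm _).trans ?_) (Real.sqrt_nonneg _)
    rw [hsum]
    simp [l2Norm]
  have h0 : 0 ≤ l2Norm g := Real.sqrt_nonneg _
  have h0' : 0 ≤ l2Norm g' := Real.sqrt_nonneg _
  rcases h0.eq_or_lt with h | h
  · rw [← h, zero_mul]; exact norm_nonneg _
  rcases h0'.eq_or_lt with h' | h'
  · rw [← h', mul_zero]; exact norm_nonneg _
  refine le_of_mul_le_mul_left ?_ (mul_pos h h')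
  nlinarith

end LowerBound

/-! ### Weyl matrices and the bound for the Bell constant -/

section Existence

/-- The product of a shift and a diagonal matrix of characters. -/
def weylMatrix {N : ℕ} [NeZero N] (a : ZMod N × ZMod N) : Matrix (ZMod N) (ZMod N) ℂ :=
  Matrix.of fun i i' => if i = i' + a.1 then ZMod.stdAddChar (i * a.2) else 0

theorem conj_stdAddChar_mul {N : ℕ} [NeZero N] (x y : ZMod N) :
    starRingEnd ℂ (ZMod.stdAddChar x) * ZMod.stdAddChar y = (ZMod.stdAddChar (y - x) : ℂ) := by
  rw [sub_eq_add_neg, AddChar.map_add_eq_mul, mul_comm, AddChar.map_neg_eq_conj]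

theorem conjTranspose_weylMatrix_mul {N : ℕ} [NeZero N] (a : ZMod N × ZMod N) :
    (weylMatrix a).conjTranspose * weylMatrix a = 1 := by
  ext i i'
  rw [Matrix.mul_apply, Finset.sum_eq_single (i + a.1)]
  · by_cases h : i = i'
    · subst h
      simp [weylMatrix, conj_stdAddChar_mul]
    · simp [weylMatrix, h]
  · intro m _ hm
    simp [weylMatrix, hm]
  · simp

/-- Different shifts leave no diagonal entry; equal shifts leave the sum of a nontrivial character.
-/
theorem trace_conjTranspose_weylMatrix_mul {N : ℕ} [NeZero N] {a b : ZMod N × ZMod N}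
    (hab : a ≠ b) : ((weylMatrix a).conjTranspose * weylMatrix b).trace = 0 := by
  have h : ((weylMatrix a).conjTranspose * weylMatrix b).trace =
      ∑ i, if a.1 = b.1 then ZMod.stdAddChar ((i + a.1) * (b.2 - a.2)) else 0 := by
    rw [Matrix.trace]
    refine Finset.sum_congr rfl fun i _ => ?_
    rw [Matrix.diag_apply, Matrix.mul_apply, Finset.sum_eq_single (i + a.1)]
    · simp [weylMatrix, conj_stdAddChar_mul, mul_sub]
    · intro m _ hm
      simp [weylMatrix, hm]
    · simp
  rw [h]
  split_ifs with h1
  · have h2 : b.2 - a.2 ≠ 0 := fun h2 => hab (Prod.ext h1 (sub_eq_zero.1 h2).symm)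
    refine (Equiv.sum_comp (Equiv.addRight a.1)
      (fun i => (ZMod.stdAddChar (i * (b.2 - a.2)) : ℂ))).trans ?_
    rw [AddChar.sum_mulShift _ (ZMod.isPrimitive_stdAddChar N), if_neg h2, Nat.cast_zero]
  · simp

theorem exists_isUnitaryBasis {N : ℕ} (hN : 1 ≤ N) :
    ∃ v : Fin (N ^ 2) → Matrix (Fin N) (Fin N) ℂ, IsUnitaryBasis v := by
  have : NeZero N := ⟨by omega⟩
  let e : Fin N ≃ ZMod N := (ZMod.finEquiv N).toEquiv
  let f : Fin (N ^ 2) ≃ ZMod N × ZMod N := Fintype.equivOfCardEq (by simp [sq, ZMod.card])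
  refine ⟨fun k => (weylMatrix (f k)).submatrix e e, fun k => ?_, fun k l hkl => ?_⟩
  · rw [Matrix.mem_unitaryGroup_iff', Matrix.star_eq_conjTranspose, Matrix.conjTranspose_submatrix,
      Matrix.submatrix_mul_equiv, conjTranspose_weylMatrix_mul, Matrix.submatrix_one_equiv]
  · rw [Matrix.conjTranspose_submatrix, Matrix.submatrix_mul_equiv]
    refine (Equiv.sum_comp e
      (fun i => ((weylMatrix (f k)).conjTranspose * weylMatrix (f l)) i i)).trans ?_
    exact trace_conjTranspose_weylMatrix_mul fun h => hkl (f.injective h)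

theorem le_bellConst {d : ℕ} {N : Fin d → ℕ} (hN : ∀ j, 1 ≤ N j) (g g' : (∀ j, Fin (N j)) → ℂ)
    (h : l2Norm g * l2Norm g' = 1) :
    (∏ j, (N j : ℝ)) ^ (-(1 / 2) : ℝ) * (injNormHilbert (rankOne g g'))⁻¹ ≤
      bellConst (fun j => N j ^ 2) := by
  choose v hv using fun j => exists_isUnitaryBasis (hN j)
  have hp : 0 < ∏ j, (N j : ℝ) := Finset.prod_pos fun j _ => by exact_mod_cast hN j
  -- When the norm vanishes, the convention `0⁻¹ = 0` makes the left side zero.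
  rcases (injNormHilbert_nonneg (rankOne g g')).eq_or_lt with h0 | h0
  · rw [← h0, inv_zero, mul_zero]
    exact bellConst_nonneg _
  refine le_trans ?_ (minNorm_div_le_bellConst (mul_pos (Real.rpow_pos_of_pos hp _) h0)
    (injNorm_basisCoeff_le hN hv (rankOne g g')))
  rw [Real.rpow_neg hp.le, ← mul_inv, ← one_div]
  exact div_le_div_of_nonneg_right (h ▸ l2Norm_mul_le_minNorm hN hv g g')
    (mul_nonneg (by positivity) h0.le)

end Existence

/-! ### Finite norming sets -/

section Nets

/-- The unit ball of a finite-dimensional complex space has a finite subset, of cardinality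
exponential in the dimension, on which linear forms attain their norm up to a factor `2`. -/
theorem exists_norming_finset (E : Type*) [NormedAddCommGroup E] [NormedSpace ℂ E]
    [FiniteDimensional ℂ E] :
    ∃ P : Finset E, (∀ p ∈ P, ‖p‖ ≤ 1) ∧ P.card ≤ 25 ^ Module.finrank ℂ E ∧
      ∀ (l : E →ₗ[ℂ] ℂ) (M : ℝ), (∀ p ∈ P, ‖l p‖ ≤ M) → ∀ q : E, ‖q‖ ≤ 1 → ‖l q‖ ≤ 2 * M := by
  classical
  have : FiniteDimensional ℝ E := FiniteDimensional.complexToReal E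
  -- A `1/2`-separated subset of the ball of largest cardinality is a `1/2`-net. Doubled, it is
  -- `1`-separated in the ball of radius `2`, so it has at most `5 ^ (2 dim) = 25 ^ dim` points,
  -- with `dim` the complex dimension.
  let sep : Finset E → Prop := fun s => (∀ p ∈ s, ‖p‖ ≤ 1) ∧
    ∀ p ∈ s, ∀ q ∈ s, p ≠ q → 1 / 2 ≤ ‖p - q‖
  have hcard : ∀ s, sep s → s.card ≤ 25 ^ Module.finrank ℂ E := by
    intro s hs
    have hinj : Function.Injective fun p : E => (2 : ℝ) • p :=
      smul_right_injective E two_ne_zero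
    rw [← Finset.card_image_of_injective s hinj]
    refine (Besicovitch.card_le_of_separated _ ?_ ?_).trans ?_
    · simp only [Finset.mem_image]
      rintro _ ⟨p, hp, rfl⟩
      rw [norm_smul, Real.norm_two]
      linarith [hs.1 p hp]
    · simp only [Finset.mem_image]
      rintro _ ⟨p, hp, rfl⟩ _ ⟨q, hq, rfl⟩ hpq
      rw [← smul_sub, norm_smul, Real.norm_two]
      linarith [hs.2 p hp q hq fun h => hpq (by rw [h])]
    · rw [finrank_real_of_complex, pow_mul]
      norm_num
  obtain ⟨s, hs, hmax⟩ : ∃ s, sep s ∧ ∀ t, sep t → t.card ≤ s.card := by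
    have hb : BddAbove (Finset.card '' {s | sep s}) := by
      refine ⟨25 ^ Module.finrank ℂ E, ?_⟩
      rintro _ ⟨s, hs, rfl⟩
      exact hcard s hs
    have hne : (Finset.card '' {s | sep s}).Nonempty := ⟨_, ∅, by simp [sep], rfl⟩
    obtain ⟨s, hs, h⟩ := Nat.sSup_mem hne hb
    exact ⟨s, hs, fun t ht => h ▸ le_csSup hb ⟨t, ht, rfl⟩⟩
  have hcov : ∀ q : E, ‖q‖ ≤ 1 → ∃ p ∈ s, ‖q - p‖ ≤ 1 / 2 := by
    intro q hq
    by_contra! h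
    have hqs : q ∉ s := fun hqs => by
      have := h q hqs
      norm_num at this
    have := hmax (insert q s) ⟨?_, ?_⟩
    · rw [Finset.card_insert_of_notMem hqs] at this
      omega
    · simp only [Finset.mem_insert]
      rintro p (rfl | hp)
      exacts [hq, hs.1 p hp]
    · simp only [Finset.mem_insert]
      rintro p (rfl | hp) p' (rfl | hp') hpp'
      · exact absurd rfl hpp'
      · exact (h p' hp').le
      · rw [norm_sub_rev]; exact (h p hp).le
      · exact hs.2 p hp p' hp' hpp'
  refine ⟨s, hs.1, hcard s hs, fun l M hM q hq => ?_⟩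
  have hM0 : 0 ≤ M := by
    obtain ⟨p, hp, -⟩ := hcov 0 (by simp)
    exact (norm_nonneg _).trans (hM p hp)
  let L : E →L[ℂ] ℂ := LinearMap.toContinuousLinearMap l
  -- Replacing a unit vector by a net point costs half the norm of `L`, which is then absorbed.
  have hL : ‖L‖ ≤ M + ‖L‖ / 2 := by
    refine L.opNorm_le_of_unit_norm (by positivity) fun x hx => ?_
    obtain ⟨p, hp, hxp⟩ := hcov x hx.le
    calc ‖L x‖ = ‖l p + L (x - p)‖ := by
          congr 1
          rw [map_sub]
          change L x = L p + (L x - L p)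
          ring
      _ ≤ ‖l p‖ + ‖L (x - p)‖ := norm_add_le _ _
      _ ≤ M + ‖L‖ * (1 / 2) := add_le_add (hM p hp)
          ((L.le_opNorm _).trans (mul_le_mul_of_nonneg_left hxp (norm_nonneg _)))
      _ = M + ‖L‖ / 2 := by ring
  calc ‖l q‖ = ‖L q‖ := rfl
    _ ≤ ‖L‖ * 1 := (L.le_opNorm _).trans (mul_le_mul_of_nonneg_left hq (norm_nonneg _))
    _ ≤ 2 * M := by linarith

theorem exists_norming_finset_submodule {E : Type*} [NormedAddCommGroup E] [NormedSpace ℂ E]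
    [FiniteDimensional ℂ E] (W : Submodule ℂ E) :
    ∃ P : Finset E, (∀ p ∈ P, p ∈ W ∧ ‖p‖ ≤ 1) ∧ P.card ≤ 25 ^ Module.finrank ℂ W ∧
      ∀ (l : E →ₗ[ℂ] ℂ) (M : ℝ), (∀ p ∈ P, ‖l p‖ ≤ M) →
        ∀ q ∈ W, ‖q‖ ≤ 1 → ‖l q‖ ≤ 2 * M := by
  obtain ⟨P, h1, h2, h3⟩ := exists_norming_finset W
  refine ⟨P.map ⟨Subtype.val, Subtype.val_injective⟩, ?_, by rwa [Finset.card_map], ?_⟩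
  · simp only [Finset.mem_map, Function.Embedding.coeFn_mk]
    rintro _ ⟨p, hp, rfl⟩
    exact ⟨p.2, h1 p hp⟩
  · intro l M hM q hq hq1
    refine h3 (l ∘ₗ W.subtype) M (fun p hp => hM p ?_) ⟨q, hq⟩ hq1
    exact Finset.mem_map_of_mem _ hp

end Nets

/-! ### Contractions with few nonzero columns -/

section Contractions

open scoped Matrix

variable {m n : Type} [Fintype m] [Fintype n]

/-- The matrices that are contractions from `ℓ₂(n)` to `ℓ₂(m)`. -/
def IsContraction (A : Matrix m n ℂ) : Prop :=
  ∀ z : n → ℂ, ∑ i, ‖(A *ᵥ z) i‖ ^ 2 ≤ ∑ k, ‖z k‖ ^ 2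

section L2Operator

open scoped Matrix.Norms.L2Operator

theorem isContraction_iff [DecidableEq n] (A : Matrix m n ℂ) : IsContraction A ↔ ‖A‖ ≤ 1 := by
  constructor
  · intro h
    rw [Matrix.l2_opNorm_def]
    refine ContinuousLinearMap.opNorm_le_bound _ zero_le_one fun x => ?_
    rw [one_mul, EuclideanSpace.norm_eq, EuclideanSpace.norm_eq]
    exact Real.sqrt_le_sqrt (h x)
  · intro h z
    have h1 := (Matrix.l2_opNorm_mulVec A (WithLp.toLp 2 z)).trans
      (mul_le_of_le_one_left (norm_nonneg _) h)
    rw [EuclideanSpace.norm_eq, EuclideanSpace.norm_eq] at h1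
    exact (Real.sqrt_le_sqrt_iff (by positivity)).1 h1

theorem IsContraction.conjTranspose [DecidableEq m] [DecidableEq n] {A : Matrix m n ℂ}
    (h : IsContraction A) : IsContraction Aᴴ := by
  rw [isContraction_iff] at h ⊢
  rwa [Matrix.l2_opNorm_conjTranspose]

end L2Operator

theorem IsContraction.map_star {A : Matrix m n ℂ} (h : IsContraction A) :
    IsContraction (A.map star) := by
  intro z
  have h1 : ∀ i, ‖(A.map star *ᵥ z) i‖ = ‖(A *ᵥ star z) i‖ := by
    intro i
    rw [← norm_star]
    congr 1
    simp [Matrix.mulVec, dotProduct]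
  simp_rw [h1]
  simpa using h (star z)

theorem IsContraction.transpose [DecidableEq m] [DecidableEq n] {A : Matrix m n ℂ}
    (h : IsContraction A) : IsContraction Aᵀ := by
  have := h.conjTranspose.map_star
  convert this using 1
  ext i j
  simp

theorem isContraction_one [DecidableEq n] : IsContraction (1 : Matrix n n ℂ) := by
  intro z
  simp

/-- The columns are orthogonal with squared norms `δ k`, so Pythagoras gives `‖Az‖² = ∑ δ k |z k|²`.
-/
theorem isContraction_of_conjTranspose_mul_self [DecidableEq n] {A : Matrix m n ℂ} {δ : n → ℝ}
    (h : Aᴴ * A = Matrix.diagonal fun k => (δ k : ℂ)) (hδ : ∀ k, δ k ≤ 1) : IsContraction A := by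
  intro z
  have h1 : ((∑ i, ‖(A *ᵥ z) i‖ ^ 2 : ℝ) : ℂ) = ((∑ k, δ k * ‖z k‖ ^ 2 : ℝ) : ℂ) := by
    push_cast
    simp_rw [← Complex.conj_mul']
    calc ∑ i, (starRingEnd ℂ) ((A *ᵥ z) i) * (A *ᵥ z) i = star (A *ᵥ z) ⬝ᵥ (A *ᵥ z) := by
          simp [dotProduct]
      _ = star z ⬝ᵥ (Aᴴ * A) *ᵥ z := by
          rw [Matrix.star_mulVec, ← Matrix.dotProduct_mulVec, Matrix.mulVec_mulVec]
      _ = _ := by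
          rw [h]
          simp only [dotProduct, Matrix.mulVec_diagonal, Pi.star_apply, Complex.star_def]
          exact Finset.sum_congr rfl fun k _ => by ring
  have h2 : ∑ i, ‖(A *ᵥ z) i‖ ^ 2 = ∑ k, δ k * ‖z k‖ ^ 2 := by exact_mod_cast h1
  rw [h2]
  exact Finset.sum_le_sum fun k _ => mul_le_of_le_one_left (by positivity) (hδ k)

/-- The matrices whose columns outside `S` vanish. -/
def colSupport (m : Type) {n : Type} (S : Finset n) : Submodule ℂ (Matrix m n ℂ) where
  carrier := {A | ∀ i, ∀ k ∉ S, A i k = 0}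
  add_mem' hA hB i k hk := by simp [hA i k hk, hB i k hk]
  zero_mem' := by simp
  smul_mem' a A hA i k hk := by simp [hA i k hk]

theorem finrank_colSupport_le (S : Finset n) :
    Module.finrank ℂ (colSupport m S) ≤ Fintype.card m * S.card := by
  let f : colSupport m S →ₗ[ℂ] (m × S → ℂ) :=
    { toFun := fun A p => A.1 p.1 p.2
      map_add' := fun _ _ => rfl
      map_smul' := fun _ _ => rfl }
  have hf : Function.Injective f := by
    intro A B hAB
    ext i k
    by_cases hk : k ∈ S
    · exact congrFun hAB (i, ⟨k, hk⟩)
    · rw [A.2 i k hk, B.2 i k hk]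
  simpa using LinearMap.finrank_le_finrank_of_injective hf

open scoped Matrix.Norms.L2Operator in
theorem exists_norming_contractions [DecidableEq n] (S : Finset n) :
    ∃ P : Finset (Matrix m n ℂ), (∀ A ∈ P, A ∈ colSupport m S ∧ IsContraction A) ∧
      P.card ≤ 25 ^ (Fintype.card m * S.card) ∧
      ∀ (l : Matrix m n ℂ →ₗ[ℂ] ℂ) (M : ℝ), (∀ A ∈ P, ‖l A‖ ≤ M) →
        ∀ A, A ∈ colSupport m S → IsContraction A → ‖l A‖ ≤ 2 * M := by
  obtain ⟨P, h1, h2, h3⟩ := exists_norming_finset_submodule (colSupport m S)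
  refine ⟨P, fun A hA => ⟨(h1 A hA).1, (isContraction_iff A).2 (h1 A hA).2⟩,
    h2.trans (Nat.pow_le_pow_right (by norm_num) (finrank_colSupport_le S)),
    fun l M hM A hA hA1 => h3 l M hM A hA ((isContraction_iff A).1 hA1)⟩

/-- A finite set of vectors of the unit ball of `ℓ₂(K)` from which the norm can be computed up to
a factor `2`. -/
theorem exists_norming_vectors (K : Finset n) :
    ∃ P : Finset (n → ℂ), (∀ z ∈ P, ∑ k, ‖z k‖ ^ 2 ≤ 1) ∧ P.card ≤ 25 ^ K.card ∧
      ∀ (a : n → ℂ) (M : ℝ), (∀ k ∉ K, a k = 0) → (∀ z ∈ P, ‖z ⬝ᵥ a‖ ≤ M) →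
        ∑ k, ‖a k‖ ^ 2 ≤ (2 * M) ^ 2 := by
  classical
  obtain ⟨P, h1, h2, h3⟩ := exists_norming_finset (EuclideanSpace ℂ K)
  let ext0 : EuclideanSpace ℂ K → n → ℂ := fun z k => if h : k ∈ K then z ⟨k, h⟩ else 0
  have hsum : ∀ f : n → ℝ, (∀ k ∉ K, f k = 0) → ∑ k, f k = ∑ k : K, f k := by
    intro f hf
    rw [Finset.sum_coe_sort K f]
    exact (Finset.sum_subset (Finset.subset_univ K) fun k _ hk => hf k hk).symm
  refine ⟨P.image ext0, ?_, Finset.card_image_le.trans (h2.trans (by simp)), ?_⟩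
  · simp only [Finset.mem_image]
    rintro _ ⟨z, hz, rfl⟩
    have := h1 z hz
    rw [EuclideanSpace.norm_eq, Real.sqrt_le_one] at this
    rw [hsum _ fun k hk => by simp [ext0, hk]]
    simpa [ext0] using this
  · intro a M ha hM
    let a' : EuclideanSpace ℂ K := WithLp.toLp 2 fun k => a k
    have hnorm : ∑ k, ‖a k‖ ^ 2 = ‖a'‖ ^ 2 := by
      rw [EuclideanSpace.norm_sq_eq, hsum _ fun k hk => by simp [ha k hk]]
    let l : EuclideanSpace ℂ K →ₗ[ℂ] ℂ :=
      { toFun := fun z => ∑ k : K, z k * a k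
        map_add' := fun x y => by simp [add_mul, Finset.sum_add_distrib]
        map_smul' := fun c x => by simp [Finset.mul_sum, mul_assoc] }
    have hl : ∀ z, l z = ext0 z ⬝ᵥ a := by
      intro z
      change ∑ k : K, z k * a k = ∑ k, ext0 z k * a k
      have : ∑ k : K, z k * a k = ∑ k : K, ext0 z k * a k :=
        Finset.sum_congr rfl fun k _ => by simp [ext0]
      rw [this, Finset.sum_coe_sort K fun k => ext0 z k * a k]
      exact Finset.sum_subset (Finset.subset_univ K) fun k _ hk => by simp [ext0, hk]
    have hl2 := h3 l M fun z hz => by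
      rw [hl]
      exact hM _ (Finset.mem_image_of_mem _ hz)
    rw [hnorm]
    have ha0 : 0 ≤ ‖a'‖ := norm_nonneg a'
    rcases ha0.eq_or_lt with h0 | h0
    · rw [← h0, zero_pow two_ne_zero]; positivity
    refine pow_le_pow_left₀ ha0 ?_ 2
    -- The pairing is bilinear, so the extremal test vector is the normalized conjugate of `a`.
    let b : EuclideanSpace ℂ K := (‖a'‖ : ℂ)⁻¹ • WithLp.toLp 2 fun k : K => star (a k)
    have hb : l b = ‖a'‖ := by
      have h4 : l (WithLp.toLp 2 fun k : K => star (a k)) = (‖a'‖ : ℂ) ^ 2 := by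
        change ∑ k : K, star (a k) * a k = _
        have : ‖a'‖ ^ 2 = ∑ k : K, ‖a k‖ ^ 2 := EuclideanSpace.norm_sq_eq a'
        rw [← Complex.ofReal_pow, this]
        push_cast
        exact Finset.sum_congr rfl fun k _ => Complex.conj_mul' _
      rw [map_smul, h4, smul_eq_mul]
      have : (‖a'‖ : ℂ) ≠ 0 := by exact_mod_cast h0.ne'
      field_simp
    have hb1 : ‖b‖ ≤ 1 := by
      have h5 : ‖(WithLp.toLp 2 fun k : K => star (a k) : EuclideanSpace ℂ K)‖ = ‖a'‖ := by
        rw [EuclideanSpace.norm_eq, EuclideanSpace.norm_eq]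
        simp [a']
      rw [norm_smul, h5, norm_inv, Complex.norm_real, norm_norm, inv_mul_cancel₀ h0.ne']
    have := hl2 b hb1
    rwa [hb, Complex.norm_real, norm_norm] at this

end Contractions

/-! ### Tensor products of matrices -/

section TensorMatrix

open scoped Matrix

variable {n : Type}

/-- The matrix of `A₁ ⊗ ⋯ ⊗ A_d`. -/
def tensorMatrix {d : ℕ} (A : Fin d → Matrix n n ℂ) :
    Matrix (Fin d → n) (Fin d → n) ℂ :=
  Matrix.of fun i k => ∏ j, A j (i j) (k j)

theorem tensorMatrix_apply {d : ℕ} (A : Fin d → Matrix n n ℂ) (i k : Fin d → n) :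
    tensorMatrix A i k = ∏ j, A j (i j) (k j) := rfl

theorem tensorMatrix_transpose {d : ℕ} (A : Fin d → Matrix n n ℂ) :
    (tensorMatrix A)ᵀ = tensorMatrix fun j => (A j)ᵀ := rfl

variable [Fintype n]

theorem tensorMatrix_mul {d : ℕ} (A B : Fin d → Matrix n n ℂ) :
    tensorMatrix A * tensorMatrix B = tensorMatrix fun j => A j * B j := by
  ext i k
  simp only [Matrix.mul_apply, tensorMatrix_apply, ← Finset.prod_mul_distrib]
  rw [Finset.prod_univ_sum, Fintype.piFinset_univ]

/-- Split off the first coordinate: the remaining factors act for each fixed value of it, then `A 0`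
acts for each fixed value of the others. -/
theorem isContraction_tensorMatrix : ∀ (d : ℕ) (A : Fin d → Matrix n n ℂ),
    (∀ j, IsContraction (A j)) → IsContraction (tensorMatrix A)
  | 0, A, _ => by
    intro z
    simp only [Matrix.mulVec, dotProduct, Fintype.sum_unique, tensorMatrix_apply,
      Fin.prod_univ_zero, one_mul, le_refl]
  | d + 1, A, hA => by
    intro z
    have ih := isContraction_tensorMatrix d (Fin.tail A) fun j => hA j.succ
    let E := Fin.consEquiv (fun _ : Fin (d + 1) => n)
    have hE : ∀ f : (Fin (d + 1) → n) → ℝ, ∑ i, f i = ∑ a, ∑ i : Fin d → n, f (Fin.cons a i) := by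
      intro f
      rw [← Fintype.sum_prod_type']
      exact (Equiv.sum_comp E f).symm
    let w : n → (Fin d → n) → ℂ := fun b => tensorMatrix (Fin.tail A) *ᵥ fun k => z (Fin.cons b k)
    have hw : ∀ a i, (tensorMatrix A *ᵥ z) (Fin.cons a i) = (A 0 *ᵥ fun b => w b i) a := by
      intro a i
      simp only [Matrix.mulVec, dotProduct, w, Finset.mul_sum]
      rw [← Fintype.sum_prod_type', ← Equiv.sum_comp E]
      refine Finset.sum_congr rfl fun p _ => ?_
      have hp : E p = Fin.cons p.1 p.2 := rfl
      simp only [tensorMatrix_apply, Fin.prod_univ_succ, hp, Fin.cons_zero, Fin.cons_succ,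
        Fin.tail]
      ring
    rw [hE, hE]
    simp_rw [hw]
    calc ∑ a, ∑ i, ‖(A 0 *ᵥ fun b => w b i) a‖ ^ 2
        = ∑ i, ∑ a, ‖(A 0 *ᵥ fun b => w b i) a‖ ^ 2 := Finset.sum_comm
      _ ≤ ∑ i, ∑ b, ‖w b i‖ ^ 2 := Finset.sum_le_sum fun i _ => hA 0 _
      _ = ∑ b, ∑ i, ‖w b i‖ ^ 2 := Finset.sum_comm
      _ ≤ ∑ b, ∑ k, ‖z (Fin.cons b k)‖ ^ 2 := Finset.sum_le_sum fun b _ => ih _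

/-- The form `a ⬝ᵥ (x₁ ⊗ ⋯ ⊗ x_d) b`, as a multilinear form in `x`. -/
def tensorForm {d : ℕ} (a b : (Fin d → n) → ℂ) :
    MultilinearMap ℂ (fun _ : Fin d => Matrix n n ℂ) ℂ :=
  ∑ i, ∑ k, (a i * b k) • (MultilinearMap.mkPiAlgebra ℂ (Fin d) ℂ).compLinearMap
    fun j => Matrix.entryLinearMap ℂ ℂ (i j) (k j)

theorem tensorForm_apply {d : ℕ} (a b : (Fin d → n) → ℂ) (x : Fin d → Matrix n n ℂ) :
    tensorForm a b x = a ⬝ᵥ (tensorMatrix x *ᵥ b) := by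
  simp only [tensorForm, sum_apply, smul_apply,
    MultilinearMap.compLinearMap_apply, MultilinearMap.mkPiAlgebra_apply,
    Matrix.entryLinearMap_apply, smul_eq_mul, dotProduct, Matrix.mulVec, Finset.mul_sum,
    tensorMatrix_apply]
  exact Finset.sum_congr rfl fun i _ => Finset.sum_congr rfl fun k _ => by ring

theorem multiform_rankOne {d N : ℕ} (g g' : (Fin d → Fin N) → ℂ)
    (x : Fin d → Fin N × Fin N → ℂ) :
    multiform (rankOne (N := fun _ => N) g g') x =
      g ⬝ᵥ (tensorMatrix (fun j => Matrix.of fun a b => x j (a, b)) *ᵥ g') := by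
  simp only [dotProduct, Matrix.mulVec, Finset.mul_sum, multiform]
  rw [← Fintype.sum_prod_type', ← Equiv.sum_comp (Equiv.arrowProdEquivProdArrow (Fin d)
    (fun _ => Fin N) (fun _ => Fin N))]
  refine Finset.sum_congr rfl fun p _ => ?_
  simp only [rankOne, tensorMatrix_apply, Matrix.of_apply, Equiv.arrowProdEquivProdArrow,
    Equiv.coe_fn_mk, Prod.mk.eta]
  ring

end TensorMatrix

/-! ### From partial isometries to the Hilbert–Schmidt ball -/

section WeakSquareSummable

/-- The smallest of `r` terms is at most their average, hence at most `K / √r`. Removing the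
smallest terms one by one leaves `K² ∑ 1/r`. -/
theorem sum_sq_le_of_sum_le {ι : Type*} (c : ι → ℝ) (hc : ∀ k, 0 ≤ c k) {K : ℝ}
    (h : ∀ S : Finset ι, S.Nonempty → ∑ k ∈ S, c k ≤ K * √S.card) (S : Finset ι) :
    ∑ k ∈ S, c k ^ 2 ≤ K ^ 2 * harmonic S.card := by
  classical
  induction hn : S.card generalizing S with
  | zero => simp [Finset.card_eq_zero.1 hn]
  | succ n ih =>
    have hne : S.Nonempty := Finset.card_pos.1 (by omega)
    obtain ⟨m, hm, hmin⟩ := Finset.exists_min_image S c hne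
    have h1 : ((n + 1 : ℕ) : ℝ) * c m ≤ K * √((n + 1 : ℕ) : ℝ) := by
      have := Finset.card_nsmul_le_sum S c (c m) hmin
      rw [nsmul_eq_mul, hn] at this
      have h2 := h S hne
      rw [hn] at h2
      exact this.trans h2
    have h2 : c m ^ 2 ≤ K ^ 2 * ((n : ℝ) + 1)⁻¹ := by
      have h3 := pow_le_pow_left₀ (mul_nonneg (Nat.cast_nonneg _) (hc m)) h1 2
      rw [mul_pow, mul_pow, Real.sq_sqrt (Nat.cast_nonneg _)] at h3
      push_cast at h3
      have h4 : (0 : ℝ) < n + 1 := by positivity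
      rw [← div_eq_mul_inv, le_div_iff₀ h4]
      nlinarith
    have h3 := ih (S.erase m) (by rw [Finset.card_erase_of_mem hm, hn]; rfl)
    rw [← Finset.add_sum_erase S _ hm, harmonic_succ]
    push_cast
    linarith

open scoped Matrix ComplexOrder

variable {n : Type} [Fintype n] [DecidableEq n]

/-- A linear form on matrices that is bounded on the normalized partial isometries of all ranks is
bounded, up to a logarithmic factor, on the Hilbert-Schmidt ball. -/
theorem sum_norm_sq_le_of_partial_isometries (M : Matrix n n ℂ) {K : ℝ}
    (h : ∀ S : Finset n, S.Nonempty → ∀ A B : Matrix n n ℂ, A ∈ colSupport n S →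
      B ∈ colSupport n S → IsContraction A → IsContraction B →
      ‖∑ i, ∑ k, M i k * (A * Bᵀ) i k‖ ≤ K * √S.card) :
    ∑ i, ∑ k, ‖M i k‖ ^ 2 ≤ K ^ 2 * harmonic (Fintype.card n) := by
  have hH : (Mᴴ * M).IsHermitian := Matrix.isHermitian_conjTranspose_mul_self M
  have hpos : ∀ k, 0 ≤ hH.eigenvalues k :=
    (Matrix.posSemidef_conjTranspose_mul_self M).eigenvalues_nonneg
  let U : Matrix n n ℂ := hH.eigenvectorUnitary
  have hU : Uᴴ * U = 1 := Matrix.mem_unitaryGroup_iff'.1 hH.eigenvectorUnitary.2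
  let c : n → ℝ := fun k => √(hH.eigenvalues k)
  have hY : (M * U)ᴴ * (M * U) = Matrix.diagonal fun k => ((hH.eigenvalues k : ℝ) : ℂ) := by
    have := hH.conjStarAlgAut_star_eigenvectorUnitary
    rw [Unitary.conjStarAlgAut_star_apply] at this
    rw [Matrix.conjTranspose_mul, ← Matrix.mul_assoc, Matrix.mul_assoc Uᴴ]
    exact this
  have hHS : ∑ i, ∑ k, ‖M i k‖ ^ 2 = ∑ k, c k ^ 2 := by
    have h1 : ((∑ i, ∑ k, ‖M i k‖ ^ 2 : ℝ) : ℂ) = ((∑ k, c k ^ 2 : ℝ) : ℂ) := by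
      simp only [c, Real.sq_sqrt (hpos _)]
      refine Eq.trans ?_ (hH.trace_eq_sum_eigenvalues.trans (Complex.ofReal_sum _ _).symm)
      rw [Matrix.trace, Finset.sum_comm]
      push_cast
      refine Finset.sum_congr rfl fun k _ => ?_
      simp [Matrix.mul_apply, ← Complex.conj_mul']
    exact_mod_cast h1
  rw [hHS, ← Finset.card_univ]
  refine sum_sq_le_of_sum_le c (fun k => Real.sqrt_nonneg _) (fun S hS => ?_) _
  -- The columns of `M * U` are orthogonal with norms `c k`, the singular values of `M`. Normalizing
  -- those in `S` and conjugating gives `A`, and the pairing of `M` with `A * Bᵀ` is `∑ k ∈ S, c k`.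
  -- A zero singular value gives a zero column, as `0⁻¹ = 0`.
  let δ : n → ℂ := fun k => if k ∈ S then 1 else 0
  let γ : n → ℂ := fun k => if k ∈ S then ((c k)⁻¹ : ℝ) else 0
  let A : Matrix n n ℂ := (M * U * Matrix.diagonal γ).map star
  let B : Matrix n n ℂ := U * Matrix.diagonal δ
  have hA : IsContraction A := by
    refine IsContraction.map_star (isContraction_of_conjTranspose_mul_self
      (δ := fun k => if k ∈ S then (c k)⁻¹ ^ 2 * hH.eigenvalues k else 0) ?_ ?_)
    · rw [Matrix.conjTranspose_mul, ← Matrix.mul_assoc, Matrix.mul_assoc _ (M * U)ᴴ, hY,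
        Matrix.diagonal_conjTranspose, Matrix.diagonal_mul_diagonal, Matrix.diagonal_mul_diagonal]
      congr 1
      ext k
      by_cases hk : k ∈ S
      · simp [γ, hk]; ring
      · simp [γ, hk]
    · intro k
      split_ifs
      · rw [inv_pow, Real.sq_sqrt (hpos k)]
        exact inv_mul_le_one
      · exact zero_le_one
  have hB : IsContraction B := by
    refine isContraction_of_conjTranspose_mul_self (δ := fun k => if k ∈ S then 1 else 0) ?_ ?_
    · rw [Matrix.conjTranspose_mul, ← Matrix.mul_assoc, Matrix.mul_assoc _ Uᴴ, hU, Matrix.mul_one,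
        Matrix.diagonal_conjTranspose, Matrix.diagonal_mul_diagonal]
      congr 1
      ext k
      by_cases hk : k ∈ S <;> simp [δ, hk]
    · intro k
      split_ifs <;> norm_num
  have hval : ∑ i, ∑ k, M i k * (A * Bᵀ) i k = ((∑ k ∈ S, c k : ℝ) : ℂ) := by
    have h1 : ∑ i, ∑ k, M i k * (A * Bᵀ) i k =
        (Matrix.diagonal (star γ) * ((M * U)ᴴ * (M * U)) * Matrix.diagonal δ).trace := by
      have h2 : Matrix.diagonal (star γ) * ((M * U)ᴴ * (M * U)) * Matrix.diagonal δ =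
          Aᵀ * (M * B) := by
        have : Aᵀ = Matrix.diagonal (star γ) * (M * U)ᴴ := by
          rw [← Matrix.diagonal_conjTranspose, ← Matrix.conjTranspose_mul]
          rfl
        rw [this]
        simp only [B, Matrix.mul_assoc]
      rw [h2, Matrix.trace_mul_comm, Matrix.mul_assoc, Matrix.trace]
      have h3 : B * Aᵀ = (A * Bᵀ)ᵀ := by rw [Matrix.transpose_mul, Matrix.transpose_transpose]
      simp only [h3, Matrix.diag_apply, Matrix.mul_apply (M := M), Matrix.transpose_apply]
    rw [h1, hY, Matrix.diagonal_mul_diagonal, Matrix.diagonal_mul_diagonal, Matrix.trace_diagonal,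
      Complex.ofReal_sum, ← Finset.sum_filter_add_sum_filter_not Finset.univ (· ∈ S)]
    rw [Finset.sum_eq_zero (s := Finset.univ.filter (· ∉ S)), add_zero]
    · refine Finset.sum_congr (by simp) fun k hk => ?_
      have h3 : (c k)⁻¹ * hH.eigenvalues k = c k := by
        rw [← Real.mul_self_sqrt (hpos k), ← mul_assoc]
        exact inv_mul_mul_self _
      simp only [Pi.star_apply, γ, δ, hk, if_true, mul_one]
      rw [Complex.star_def, Complex.conj_ofReal]
      exact_mod_cast h3
    · intro k hk
      simp only [Finset.mem_filter, Finset.mem_univ, true_and] at hk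
      simp [γ, hk]
  have := h S hS A B (fun i k hk => by simp [A, γ, hk, Matrix.mul_diagonal])
    (fun i k hk => by simp [B, δ, hk, Matrix.mul_diagonal]) hA hB
  rw [hval, Complex.norm_real] at this
  exact (le_abs_self _).trans this

end WeakSquareSummable

/-! ### Gaussian tails and small balls -/

section Gaussian

open MeasureTheory ProbabilityTheory

/-- The law of an i.i.d. family of standard normal random variables. -/
abbrev stdGaussianPi (ι : Type) [Fintype ι] : Measure (ι → ℝ) :=
  Measure.pi fun _ : ι => gaussianReal 0 1

variable {ι : Type} [Fintype ι]

theorem hasSubgaussianMGF_sum (a : ι → ℝ) {σ : ℝ} (ha : ∑ i, a i ^ 2 ≤ σ ^ 2) :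
    HasSubgaussianMGF (fun g : ι → ℝ => ∑ i, a i * g i) ⟨σ ^ 2, sq_nonneg σ⟩
      (stdGaussianPi ι) := by
  have h0 : HasSubgaussianMGF id 1 (gaussianReal 0 1) :=
    ⟨fun t => by simpa using integrable_exp_mul_gaussianReal t, fun t => by
      rw [mgf_id_gaussianReal]; simp⟩
  have h1 : ∀ i, HasSubgaussianMGF (fun g : ι → ℝ => g i) 1 (stdGaussianPi ι) := by
    intro i
    have hm := measurePreserving_eval (fun _ : ι => gaussianReal 0 1) i
    exact HasSubgaussianMGF.of_map (X := id) hm.measurable.aemeasurable (hm.map_eq.symm ▸ h0)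
  have h2 := HasSubgaussianMGF.sum_of_iIndepFun
    (iIndepFun_pi (μ := fun _ : ι => gaussianReal 0 1) (X := fun i x => a i * x)
      fun i => by fun_prop) (s := Finset.univ) fun i _ => (h1 i).const_mul (a i)
  refine ⟨h2.integrable_exp_mul, fun t => (h2.mgf_le t).trans (Real.exp_le_exp.2 ?_)⟩
  refine div_le_div_of_nonneg_right (mul_le_mul_of_nonneg_right ?_ (sq_nonneg t)) zero_le_two
  rw [NNReal.coe_sum]
  exact (Finset.sum_congr rfl fun i _ => mul_one _).trans_le ha

theorem measureReal_le_sum_mul (a : ι → ℝ) {σ t : ℝ} (ha : ∑ i, a i ^ 2 ≤ σ ^ 2) (ht : 0 ≤ t) :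
    (stdGaussianPi ι).real {g | t ≤ ∑ i, a i * g i} ≤ Real.exp (-t ^ 2 / (2 * σ ^ 2)) :=
  (hasSubgaussianMGF_sum a ha).measure_ge_le ht

/-- If the modulus is at least `t`, then one of `± Re`, `± Im` is at least `t / √2`. This produces
the factor `4` and the `4 * σ ^ 2`. -/
theorem measure_le_norm_sum_mul (c : ι → ℂ) {σ t : ℝ} (hc : ∑ i, ‖c i‖ ^ 2 ≤ σ ^ 2) (ht : 0 ≤ t) :
    stdGaussianPi ι {g | t ≤ ‖∑ i, (g i : ℂ) * c i‖} ≤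
      ENNReal.ofReal (4 * Real.exp (-t ^ 2 / (4 * σ ^ 2))) := by
  have hre : ∀ i, (c i).re ^ 2 + (c i).im ^ 2 = ‖c i‖ ^ 2 := fun i => by
    rw [Complex.sq_norm, Complex.normSq_apply]; ring
  have hr : ∑ i, (c i).re ^ 2 ≤ σ ^ 2 :=
    (Finset.sum_le_sum fun i _ => by rw [← hre]; nlinarith [sq_nonneg (c i).im]).trans hc
  have hi : ∑ i, (c i).im ^ 2 ≤ σ ^ 2 :=
    (Finset.sum_le_sum fun i _ => by rw [← hre]; nlinarith [sq_nonneg (c i).re]).trans hc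
  set s := t / √2 with hs
  have hs0 : 0 ≤ s := by positivity
  have hs2 : 2 * s ^ 2 = t ^ 2 := by
    rw [hs, div_pow, Real.sq_sqrt zero_le_two]; ring
  have hexp : -s ^ 2 / (2 * σ ^ 2) = -t ^ 2 / (4 * σ ^ 2) := by
    rw [← hs2, show -(2 * s ^ 2) = 2 * -s ^ 2 by ring, show 4 * σ ^ 2 = 2 * (2 * σ ^ 2) by ring,
      mul_div_mul_left _ _ two_ne_zero]
  have hset : {g : ι → ℝ | t ≤ ‖∑ i, (g i : ℂ) * c i‖} ⊆
      ({g | s ≤ ∑ i, (c i).re * g i} ∪ {g | s ≤ ∑ i, (-(c i).re) * g i}) ∪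
      ({g | s ≤ ∑ i, (c i).im * g i} ∪ {g | s ≤ ∑ i, (-(c i).im) * g i}) := by
    intro g hg
    simp only [Set.mem_ofPred_eq, Set.mem_union, neg_mul, Finset.sum_neg_distrib] at hg ⊢
    by_contra! h
    obtain ⟨⟨h1, h2⟩, h3, h4⟩ := h
    have hR : (∑ i, (g i : ℂ) * c i).re = ∑ i, (c i).re * g i := by
      simp [Complex.re_sum, mul_comm]
    have hI : (∑ i, (g i : ℂ) * c i).im = ∑ i, (c i).im * g i := by
      simp [Complex.im_sum, mul_comm]
    have h5 : ‖∑ i, (g i : ℂ) * c i‖ ^ 2 =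
        (∑ i, (c i).re * g i) ^ 2 + (∑ i, (c i).im * g i) ^ 2 := by
      rw [Complex.sq_norm, Complex.normSq_apply, hR, hI]; ring
    have h6 := pow_le_pow_left₀ ht hg 2
    have h7 := sq_lt_sq' (by linarith : -s < ∑ i, (c i).re * g i) h1
    have h8 := sq_lt_sq' (by linarith : -s < ∑ i, (c i).im * g i) h3
    linarith
  have hb : ∀ a : ι → ℝ, ∑ i, a i ^ 2 ≤ σ ^ 2 → stdGaussianPi ι {g | s ≤ ∑ i, a i * g i} ≤
      ENNReal.ofReal (Real.exp (-t ^ 2 / (4 * σ ^ 2))) := by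
    intro a ha
    rw [← hexp, ← ofReal_measureReal]
    exact ENNReal.ofReal_le_ofReal (measureReal_le_sum_mul a ha hs0)
  refine (measure_mono hset).trans ?_
  have h4 : ENNReal.ofReal (4 * Real.exp (-t ^ 2 / (4 * σ ^ 2))) =
      (ENNReal.ofReal (Real.exp (-t ^ 2 / (4 * σ ^ 2))) +
        ENNReal.ofReal (Real.exp (-t ^ 2 / (4 * σ ^ 2)))) +
      (ENNReal.ofReal (Real.exp (-t ^ 2 / (4 * σ ^ 2))) +
        ENNReal.ofReal (Real.exp (-t ^ 2 / (4 * σ ^ 2)))) := by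
    rw [← ENNReal.ofReal_add (by positivity) (by positivity),
      ← ENNReal.ofReal_add (by positivity) (by positivity)]
    congr 1
    ring
  rw [h4]
  refine (measure_union_le _ _).trans (add_le_add
    ((measure_union_le _ _).trans (add_le_add (hb _ hr) (hb _ (by simpa using hr))))
    ((measure_union_le _ _).trans (add_le_add (hb _ hi) (hb _ (by simpa using hi)))))

/-- The tail bound, conditionally on the second component of a Gaussian pair. -/
theorem gaussianPair_le_norm_sum_mul {c : (ι → ℝ) → ι → ℂ} (hc : Measurable c) {σ t : ℝ}
    (ht : 0 ≤ t) :
    gaussianPair ι {ω | ∑ i, ‖c ω.2 i‖ ^ 2 ≤ σ ^ 2 ∧ t ≤ ‖∑ i, (ω.1 i : ℂ) * c ω.2 i‖} ≤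
      ENNReal.ofReal (4 * Real.exp (-t ^ 2 / (4 * σ ^ 2))) := by
  have hm : MeasurableSet {ω : (ι → ℝ) × (ι → ℝ) |
      ∑ i, ‖c ω.2 i‖ ^ 2 ≤ σ ^ 2 ∧ t ≤ ‖∑ i, (ω.1 i : ℂ) * c ω.2 i‖} := by
    have h1 : MeasurableSet {ω : (ι → ℝ) × (ι → ℝ) | ∑ i, ‖c ω.2 i‖ ^ 2 ≤ σ ^ 2} :=
      measurableSet_le (by fun_prop) (by fun_prop)
    have h2 : MeasurableSet {ω : (ι → ℝ) × (ι → ℝ) | t ≤ ‖∑ i, (ω.1 i : ℂ) * c ω.2 i‖} :=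
      measurableSet_le (by fun_prop) (by fun_prop)
    exact h1.inter h2
  rw [gaussianPair, Measure.prod_apply_symm hm]
  calc _ ≤ ∫⁻ _, ENNReal.ofReal (4 * Real.exp (-t ^ 2 / (4 * σ ^ 2))) ∂(stdGaussianPi ι) := by
        refine lintegral_mono fun g' => ?_
        by_cases h : ∑ i, ‖c g' i‖ ^ 2 ≤ σ ^ 2
        · refine (measure_mono ?_).trans (measure_le_norm_sum_mul (c g') h ht)
          exact fun g hg => hg.2
        · have : (fun g => (g, g')) ⁻¹' {ω : (ι → ℝ) × (ι → ℝ) |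
              ∑ i, ‖c ω.2 i‖ ^ 2 ≤ σ ^ 2 ∧ t ≤ ‖∑ i, (ω.1 i : ℂ) * c ω.2 i‖} = ∅ := by
            ext g
            simp [h]
          rw [this, measure_empty]
          exact zero_le
    _ = _ := by simp

theorem integral_exp_neg_mul_sq_gaussianReal {b : ℝ} (hb : 0 < b + 1 / 2) :
    ∫ x, Real.exp (-b * x ^ 2) ∂(gaussianReal 0 1) = √((2 * b + 1)⁻¹) := by
  rw [integral_gaussianReal_eq_integral_smul one_ne_zero]
  have h : ∀ x : ℝ, gaussianPDFReal 0 1 x • Real.exp (-b * x ^ 2) =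
      (√(2 * Real.pi))⁻¹ * Real.exp (-(b + 1 / 2) * x ^ 2) := by
    intro x
    simp only [gaussianPDFReal, NNReal.coe_one, mul_one, sub_zero, smul_eq_mul]
    rw [mul_assoc, ← Real.exp_add]
    congr 2
    ring
  simp_rw [h]
  rw [integral_const_mul, integral_gaussian, ← Real.sqrt_inv, ← Real.sqrt_mul (by positivity)]
  congr 1
  have := Real.pi_pos.ne'
  have h3 : 2 * b + 1 ≠ 0 := by linarith
  field_simp

/-- A small ball estimate for Gaussian vectors. -/
theorem exists_measure_sum_sq_le : ∃ δ > (0 : ℝ), ∀ (ι : Type) [Fintype ι],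
    stdGaussianPi ι {g | ∑ i, g i ^ 2 ≤ δ * Fintype.card ι} ≤
      ENNReal.ofReal (Real.exp (-3 * Fintype.card ι)) := by
  -- Chosen so that `E exp (-b x²) = (2b + 1)^(-1/2) = exp (-4)`. Markov's inequality at level `exp
  -- (-n)` then leaves `exp (-3n)` in dimension `n`.
  set b : ℝ := (Real.exp 8 - 1) / 2 with hb
  have hb0 : 0 < b := by
    have := Real.add_one_lt_exp (show (8 : ℝ) ≠ 0 by norm_num)
    rw [hb]; linarith
  refine ⟨b⁻¹, inv_pos.2 hb0, fun ι _ => ?_⟩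
  have h1 : ∫ x, Real.exp (-b * x ^ 2) ∂(gaussianReal 0 1) = Real.exp (-4) := by
    rw [integral_exp_neg_mul_sq_gaussianReal (by linarith),
      show (2 * b + 1)⁻¹ = Real.exp (-4) ^ 2 by
        rw [← Real.exp_nat_mul, show 2 * b + 1 = Real.exp 8 by rw [hb]; ring, ← Real.exp_neg]
        norm_num, Real.sqrt_sq (Real.exp_pos _).le]
  have h2 : ∫ g : ι → ℝ, Real.exp (-b * ∑ i, g i ^ 2) ∂(stdGaussianPi ι) =
      Real.exp (-4 * Fintype.card ι) := by
    have := integral_fintype_prod_eq_pow (ι := ι) (μ := gaussianReal 0 1)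
      (fun x : ℝ => Real.exp (-b * x ^ 2))
    rw [h1, ← Real.exp_nat_mul] at this
    simp_rw [Finset.mul_sum, Real.exp_sum]
    rw [this, mul_comm]
  have hint : Integrable (fun g : ι → ℝ => Real.exp (-b * ∑ i, g i ^ 2)) (stdGaussianPi ι) := by
    by_contra h
    rw [integral_undef h] at h2
    exact (Real.exp_pos _).ne h2
  have h3 := mul_meas_ge_le_integral_of_nonneg
    (Filter.Eventually.of_forall fun g : ι → ℝ => (Real.exp_pos (-b * ∑ i, g i ^ 2)).le) hint
    (Real.exp (-Fintype.card ι))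
  rw [h2] at h3
  have hset : {g : ι → ℝ | ∑ i, g i ^ 2 ≤ b⁻¹ * Fintype.card ι} ⊆
      {g | Real.exp (-Fintype.card ι) ≤ Real.exp (-b * ∑ i, g i ^ 2)} := by
    intro g hg
    simp only [Set.mem_ofPred_eq] at hg ⊢
    rw [Real.exp_le_exp]
    have := mul_le_mul_of_nonneg_left hg hb0.le
    rw [mul_inv_cancel_left₀ hb0.ne'] at this
    linarith
  refine (measure_mono hset).trans ?_
  rw [← ofReal_measureReal]
  refine ENNReal.ofReal_le_ofReal ?_
  refine le_of_mul_le_mul_left (h3.trans (le_of_eq ?_)) (Real.exp_pos (-Fintype.card ι))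
  rw [← Real.exp_add]
  congr 1
  ring

end Gaussian

/-! ### Uniform bounds for fixed supports -/

section PartialIsometries

open scoped Matrix
open MeasureTheory

variable {d N : ℕ}

/-- Families of contractions with columns supported in the sets `S j`. -/
def IsAdmissible (S : Fin d → Finset (Fin N)) (B : Fin d → Matrix (Fin N) (Fin N) ℂ) : Prop :=
  ∀ j, B j ∈ colSupport (Fin N) (S j) ∧ IsContraction (B j)

theorem dotProduct_transpose_mulVec {m n : Type} [Fintype m] [Fintype n] (M : Matrix m n ℂ)
    (z : n → ℂ) (g : m → ℂ) : z ⬝ᵥ (Mᵀ *ᵥ g) = g ⬝ᵥ (M *ᵥ z) := by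
  rw [Matrix.mulVec_transpose, Matrix.dotProduct_mulVec, dotProduct_comm]

/-- With `B` fixed the value is multilinear in `A`; the companion lemma fixes `A`. Together they let
the nets for `A` and for `B` be removed separately. -/
theorem dotProduct_tensorMatrix_eq_left (A B : Fin d → Matrix (Fin N) (Fin N) ℂ)
    (g g' : (Fin d → Fin N) → ℂ) :
    g ⬝ᵥ (tensorMatrix (fun j => A j * (B j)ᵀ) *ᵥ g') =
      tensorForm g ((tensorMatrix B)ᵀ *ᵥ g') A := by
  rw [tensorForm_apply, tensorMatrix_transpose, Matrix.mulVec_mulVec, tensorMatrix_mul]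

theorem dotProduct_tensorMatrix_eq_right (A B : Fin d → Matrix (Fin N) (Fin N) ℂ)
    (g g' : (Fin d → Fin N) → ℂ) :
    g ⬝ᵥ (tensorMatrix (fun j => A j * (B j)ᵀ) *ᵥ g') =
      tensorForm g' ((tensorMatrix A)ᵀ *ᵥ g) B := by
  rw [dotProduct_tensorMatrix_eq_left, tensorForm_apply, tensorForm_apply,
    ← dotProduct_transpose_mulVec, dotProduct_comm, ← dotProduct_transpose_mulVec,
    Matrix.transpose_transpose, dotProduct_comm]

theorem measure_biUnion_le_card {α Ω : Type*} [MeasurableSpace Ω] (μ : Measure Ω) (s : Finset α)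
    (E : α → Set Ω) {K : ℕ} {b : ℝ} (hK : s.card ≤ K)
    (hE : ∀ p ∈ s, μ (E p) ≤ ENNReal.ofReal b) :
    μ (⋃ p ∈ s, E p) ≤ ENNReal.ofReal (K * b) := by
  refine (measure_biUnion_finset_le s E).trans ((Finset.sum_le_sum hE).trans ?_)
  rw [Finset.sum_const, nsmul_eq_mul, ENNReal.ofReal_mul (Nat.cast_nonneg _),
    ENNReal.ofReal_natCast]
  gcongr

theorem pow_mul_four_exp (n : ℕ) (m a : ℝ) :
    ((25 ^ n : ℕ) : ℝ) * (4 * Real.exp (-(a * m))) =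
      4 * Real.exp (n * Real.log 25 - a * m) := by
  rw [sub_eq_add_neg, Real.exp_add, Real.exp_nat_mul, Real.exp_log (by norm_num)]
  push_cast
  ring

/-- Uniform bound for the norms `‖(B₁ ⊗ ⋯ ⊗ B_d)ᵀ g‖` over admissible families, where the
leg `j₀` is taken to be trivial. -/
theorem measure_transpose_mulVec_le (S : Fin d → Finset (Fin N)) (j₀ : Fin d)
    (hS : ∀ j, (S j).Nonempty) {a : ℝ} (ha : 0 ≤ a) {L : ℕ}
    (hL : L = N * ∏ j ∈ Finset.univ.erase j₀, (S j).card) :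
    stdGaussianPi (Fin d → Fin N) {g | ¬ ∀ B, IsAdmissible S B →
      ∑ k, ‖((tensorMatrix B)ᵀ *ᵥ fun i => (g i : ℂ)) k‖ ^ 2 ≤
        (2 * (2 ^ d * (2 * √(a * L)))) ^ 2} ≤
      ENNReal.ofReal (4 * Real.exp (((d + 1) * L : ℕ) * Real.log 25 - a * L)) := by
  classical
  choose P hP1 hP2 hP3 using fun j => exists_norming_contractions (m := Fin N) (S j)
  -- Leg `j₀` is frozen at the identity and needs no net. The other legs have nets in dimension at
  -- most `L`, and the test vectors live on the `L` columns in `K`.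
  let P' : Fin d → Finset (Matrix (Fin N) (Fin N) ℂ) := fun j => if j = j₀ then {1} else P j
  let Q : Fin d → Set (Matrix (Fin N) (Fin N) ℂ) := fun j =>
    if j = j₀ then {1} else {A | A ∈ colSupport (Fin N) (S j) ∧ IsContraction A}
  let K : Finset (Fin d → Fin N) := Fintype.piFinset (Function.update S j₀ Finset.univ)
  obtain ⟨Z, hZ1, hZ2, hZ3⟩ := exists_norming_vectors K
  have hKcard : K.card = L := by
    rw [hL, Fintype.card_piFinset, ← Finset.mul_prod_erase _ _ (Finset.mem_univ j₀),
      Function.update_self, Finset.card_univ, Fintype.card_fin]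
    congr 1
    refine Finset.prod_congr rfl fun j hj => ?_
    rw [Function.update_of_ne (Finset.ne_of_mem_erase hj)]
  have hP'1 : ∀ j, ∀ A ∈ P' j, IsContraction A := by
    intro j A hA
    by_cases hj : j = j₀
    · simp only [P', hj, if_true, Finset.mem_singleton] at hA
      exact hA ▸ isContraction_one
    · simp only [P', hj, if_false] at hA
      exact (hP1 j A hA).2
  have hP'2 : ∀ j, (P' j).card ≤ 25 ^ L := by
    intro j
    by_cases hj : j = j₀
    · simp only [P', hj, if_true, Finset.card_singleton]
      exact Nat.one_le_pow _ _ (by norm_num)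
    · simp only [P', hj, if_false]
      refine (hP2 j).trans (Nat.pow_le_pow_right (by norm_num) ?_)
      rw [Fintype.card_fin, hL]
      refine Nat.mul_le_mul_left _ (Finset.single_le_prod' (f := fun j => (S j).card)
        (fun j _ => (hS j).card_pos) (Finset.mem_erase.2 ⟨hj, Finset.mem_univ j⟩))
  have hcard : (Fintype.piFinset P' ×ˢ Z).card ≤ 25 ^ ((d + 1) * L) := by
    rw [Finset.card_product, Fintype.card_piFinset]
    calc (∏ j, (P' j).card) * Z.card ≤ (∏ _j : Fin d, 25 ^ L) * 25 ^ L :=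
          Nat.mul_le_mul (Finset.prod_le_prod' fun j _ => hP'2 j) (hKcard ▸ hZ2)
      _ = 25 ^ ((d + 1) * L) := by
          rw [Finset.prod_const, Finset.card_univ, Fintype.card_fin, ← pow_mul, ← pow_add]
          congr 1
          ring
  have hleg : ∀ j (l : Matrix (Fin N) (Fin N) ℂ →ₗ[ℂ] ℂ) (M : ℝ),
      (∀ p ∈ (P' j : Set (Matrix (Fin N) (Fin N) ℂ)), ‖l p‖ ≤ M) → ∀ q ∈ Q j, ‖l q‖ ≤ 2 * M := by
    intro j l M hM q hq
    by_cases hj : j = j₀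
    · simp only [P', Q, hj, if_true, Finset.coe_singleton, Set.mem_singleton_iff,
        forall_eq] at hM hq
      rw [hq]
      linarith [norm_nonneg (l 1)]
    · simp only [P', Q, hj, if_false, Finset.mem_coe] at hM hq
      exact hP3 j l M hM q hq.1 hq.2
  -- With this `t` the tail of each net point is `4 exp (-a L)`, to be weighed against `25 ^ ((d +
  -- 1) * L)` points.
  set t := 2 * √(a * L) with ht
  have ht0 : 0 ≤ t := by positivity
  have hsub : {g : (Fin d → Fin N) → ℝ | ¬ ∀ B, IsAdmissible S B →
      ∑ k, ‖((tensorMatrix B)ᵀ *ᵥ fun i => (g i : ℂ)) k‖ ^ 2 ≤ (2 * (2 ^ d * t)) ^ 2} ⊆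
      ⋃ p ∈ Fintype.piFinset P' ×ˢ Z, {g | t ≤ ‖∑ i, (g i : ℂ) * (tensorMatrix p.1 *ᵥ p.2) i‖} := by
    intro g hg
    by_contra hn
    refine hg fun B hB => ?_
    simp only [Set.mem_iUnion, not_exists, Set.mem_ofPred_eq, not_le] at hn
    set G : (Fin d → Fin N) → ℂ := fun i => (g i : ℂ) with hG
    have h1 : ∀ B', (∀ j, B' j ∈ Q j) → ∑ k, ‖((tensorMatrix B')ᵀ *ᵥ G) k‖ ^ 2 ≤
        (2 * (2 ^ d * t)) ^ 2 := by
      intro B' hB'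
      refine hZ3 _ _ (fun k hk => ?_) fun z hz => ?_
      · obtain ⟨j, hj⟩ : ∃ j, k j ∉ Function.update S j₀ Finset.univ j := by
          by_contra! h
          exact hk (Fintype.mem_piFinset.2 h)
        have hjj : j ≠ j₀ := by
          rintro rfl
          simp at hj
        rw [Function.update_of_ne hjj] at hj
        have hB'j := hB' j
        simp only [Q, hjj, if_false] at hB'j
        refine Finset.sum_eq_zero fun i _ => ?_
        change tensorMatrix B' i k * G i = 0
        rw [tensorMatrix_apply,
          Finset.prod_eq_zero (Finset.mem_univ j) (hB'j.1 _ _ hj), zero_mul]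
      · rw [dotProduct_transpose_mulVec, ← tensorForm_apply]
        have := norm_le_of_forall_legs (tensorForm G z) (fun j => (P' j : Set _)) Q hleg
          (M := t) (fun x hx => ?_) hB'
        · simpa using this
        · rw [tensorForm_apply]
          exact (hn (x, z) (Finset.mem_product.2 ⟨Fintype.mem_piFinset.2 hx, hz⟩)).le
    -- Leg `j₀` factors out as `C`; after transposition it acts last, as a contraction, and does not
    -- increase the norm.
    let B' : Fin d → Matrix (Fin N) (Fin N) ℂ := Function.update B j₀ 1
    let C : Fin d → Matrix (Fin N) (Fin N) ℂ := Function.update (fun _ => 1) j₀ (B j₀)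
    have hBC : tensorMatrix B = tensorMatrix B' * tensorMatrix C := by
      rw [tensorMatrix_mul]
      congr 1
      ext j : 1
      by_cases hj : j = j₀
      · subst hj; simp [B', C]
      · simp [B', C, hj]
    have hC : IsContraction (tensorMatrix C)ᵀ := by
      refine (isContraction_tensorMatrix d C fun j => ?_).transpose
      by_cases hj : j = j₀
      · subst hj; simpa [C] using (hB j).2
      · simpa [C, hj] using isContraction_one
    rw [hBC, Matrix.transpose_mul, ← Matrix.mulVec_mulVec]
    refine (hC _).trans (h1 B' fun j => ?_)
    by_cases hj : j = j₀
    · subst hj; simp [B', Q]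
    · simpa [B', Q, hj] using hB j
  refine (measure_mono hsub).trans ?_
  rw [← pow_mul_four_exp]
  refine measure_biUnion_le_card _ _ _ hcard fun p hp => ?_
  obtain ⟨hp1, hp2⟩ := Finset.mem_product.1 hp
  have hc : ∑ i, ‖(tensorMatrix p.1 *ᵥ p.2) i‖ ^ 2 ≤ (1 : ℝ) ^ 2 := by
    rw [one_pow]
    exact (isContraction_tensorMatrix d p.1
      (fun j => hP'1 j _ (Fintype.mem_piFinset.1 hp1 j)) _).trans (hZ1 _ hp2)
  refine (measure_le_norm_sum_mul _ hc ht0).trans (le_of_eq ?_)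
  rw [ht, mul_pow, Real.sq_sqrt (by positivity)]
  congr 4
  ring

/-- Uniform bound for the bilinear forms `g ⬝ᵥ (A₁B₁ᵀ ⊗ ⋯ ⊗ A_dB_dᵀ) g'` over admissible
families, conditionally on `g'`. -/
theorem gaussianPair_form_le (S : Fin d → Finset (Fin N)) {ρ : ℕ} (hρ : ∀ j, (S j).card ≤ ρ)
    {a σ : ℝ} (ha : 0 ≤ a) (hσ : 0 < σ) :
    gaussianPair (Fin d → Fin N)
      {ω | (∀ B, IsAdmissible S B →
          ∑ k, ‖((tensorMatrix B)ᵀ *ᵥ fun i => (ω.2 i : ℂ)) k‖ ^ 2 ≤ σ ^ 2) ∧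
        ¬ ∀ A B, IsAdmissible S A → IsAdmissible S B →
          ‖(fun i => (ω.1 i : ℂ)) ⬝ᵥ
            (tensorMatrix (fun j => A j * (B j)ᵀ) *ᵥ fun i => (ω.2 i : ℂ))‖ ≤
          2 ^ d * (2 ^ d * (2 * σ * √(a * (N * ρ : ℕ))))} ≤
      ENNReal.ofReal
        (4 * Real.exp ((2 * d * (N * ρ) : ℕ) * Real.log 25 - a * (N * ρ : ℕ))) := by
  classical
  choose P hP1 hP2 hP3 using fun j => exists_norming_contractions (m := Fin N) (S j)
  have hPadm : ∀ A ∈ Fintype.piFinset P, IsAdmissible S A := fun A hA j =>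
    hP1 j _ (Fintype.mem_piFinset.1 hA j)
  have hPcard : (Fintype.piFinset P).card ≤ 25 ^ (d * (N * ρ)) := by
    rw [Fintype.card_piFinset]
    calc ∏ j, (P j).card ≤ ∏ _j : Fin d, 25 ^ (N * ρ) := by
          refine Finset.prod_le_prod' fun j _ => (hP2 j).trans
            (Nat.pow_le_pow_right (by norm_num) ?_)
          rw [Fintype.card_fin]
          exact Nat.mul_le_mul_left _ (hρ j)
      _ = 25 ^ (d * (N * ρ)) := by
          rw [Finset.prod_const, Finset.card_univ, Fintype.card_fin, ← pow_mul, mul_comm]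
  have hcard : (Fintype.piFinset P ×ˢ Fintype.piFinset P).card ≤ 25 ^ (2 * d * (N * ρ)) := by
    rw [Finset.card_product]
    refine (Nat.mul_le_mul hPcard hPcard).trans (le_of_eq ?_)
    rw [← pow_add]
    congr 1
    ring
  let Q : Fin d → Set (Matrix (Fin N) (Fin N) ℂ) := fun j =>
    {A | A ∈ colSupport (Fin N) (S j) ∧ IsContraction A}
  have hleg : ∀ j (l : Matrix (Fin N) (Fin N) ℂ →ₗ[ℂ] ℂ) (M : ℝ),
      (∀ p ∈ (P j : Set (Matrix (Fin N) (Fin N) ℂ)), ‖l p‖ ≤ M) →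
      ∀ q ∈ Q j, ‖l q‖ ≤ 2 * M :=
    fun j l M hM q hq => hP3 j l M hM q hq.1 hq.2
  set t := 2 * σ * √(a * (N * ρ : ℕ)) with ht
  have ht0 : 0 ≤ t := by positivity
  let c : (Fin d → Matrix (Fin N) (Fin N) ℂ) × (Fin d → Matrix (Fin N) (Fin N) ℂ) →
      ((Fin d → Fin N) → ℝ) → (Fin d → Fin N) → ℂ := fun p g' =>
    tensorMatrix p.1 *ᵥ ((tensorMatrix p.2)ᵀ *ᵥ fun i => (g' i : ℂ))
  have hcm : ∀ p, Measurable (c p) := by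
    intro p
    refine Continuous.measurable ?_
    simp only [c]
    fun_prop
  have hsub : {ω : ((Fin d → Fin N) → ℝ) × ((Fin d → Fin N) → ℝ) |
        (∀ B, IsAdmissible S B →
          ∑ k, ‖((tensorMatrix B)ᵀ *ᵥ fun i => (ω.2 i : ℂ)) k‖ ^ 2 ≤ σ ^ 2) ∧
        ¬ ∀ A B, IsAdmissible S A → IsAdmissible S B →
          ‖(fun i => (ω.1 i : ℂ)) ⬝ᵥ
            (tensorMatrix (fun j => A j * (B j)ᵀ) *ᵥ fun i => (ω.2 i : ℂ))‖ ≤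
          2 ^ d * (2 ^ d * t)} ⊆
      ⋃ p ∈ Fintype.piFinset P ×ˢ Fintype.piFinset P,
        {ω | ∑ i, ‖c p ω.2 i‖ ^ 2 ≤ σ ^ 2 ∧ t ≤ ‖∑ i, (ω.1 i : ℂ) * c p ω.2 i‖} := by
    rintro ⟨g, g'⟩ ⟨h1, h2⟩
    by_contra hn
    refine h2 fun A B hA hB => ?_
    simp only [Set.mem_iUnion, not_exists, Set.mem_ofPred_eq, not_and, not_le] at hn
    set G : (Fin d → Fin N) → ℂ := fun i => (g i : ℂ) with hG
    set G' : (Fin d → Fin N) → ℂ := fun i => (g' i : ℂ) with hG'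
    rw [dotProduct_tensorMatrix_eq_right]
    have hstep : ∀ B' ∈ Fintype.piFinset P,
        ‖tensorForm G' ((tensorMatrix A)ᵀ *ᵥ G) B'‖ ≤ 2 ^ d * t := by
      intro B' hB'
      rw [← dotProduct_tensorMatrix_eq_right, dotProduct_tensorMatrix_eq_left]
      have := norm_le_of_forall_legs (tensorForm G ((tensorMatrix B')ᵀ *ᵥ G'))
        (fun j => (P j : Set _)) Q hleg (M := t) (fun x hx => ?_) hA
      · simpa using this
      · have hx' : x ∈ Fintype.piFinset P := Fintype.mem_piFinset.2 hx
        rw [tensorForm_apply]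
        refine (hn (x, B') (Finset.mem_product.2 ⟨hx', hB'⟩) ?_).le
        exact (isContraction_tensorMatrix d x (fun j => (hPadm x hx' j).2) _).trans
          (h1 B' (hPadm B' hB'))
    have := norm_le_of_forall_legs (tensorForm G' ((tensorMatrix A)ᵀ *ᵥ G))
      (fun j => (P j : Set _)) Q hleg (M := 2 ^ d * t)
      (fun x hx => hstep x (Fintype.mem_piFinset.2 hx)) hB
    simpa using this
  refine (measure_mono hsub).trans ?_
  rw [← pow_mul_four_exp]
  refine measure_biUnion_le_card _ _ _ hcard fun p _ => ?_
  refine (gaussianPair_le_norm_sum_mul (hcm p) ht0).trans (le_of_eq ?_)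
  rw [ht, mul_pow, Real.sq_sqrt (by positivity)]
  congr 3
  field_simp
  ring

end PartialIsometries

/-! ### Union over all supports -/

section GaussianTensor

open scoped Matrix
open MeasureTheory

variable {d N : ℕ}

/-- No measurability of `s` is required, so events over infinite families of contractions may be
used directly. -/
theorem gaussianPair_snd_preimage {ι : Type} [Fintype ι] (s : Set (ι → ℝ)) :
    gaussianPair ι {ω | ω.2 ∈ s} = stdGaussianPi ι s := by
  have : {ω : (ι → ℝ) × (ι → ℝ) | ω.2 ∈ s} = Set.univ ×ˢ s := by
    ext ω; simp
  rw [this, gaussianPair, Measure.prod_prod, measure_univ, one_mul]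

theorem gaussianPair_fst_preimage {ι : Type} [Fintype ι] (s : Set (ι → ℝ)) :
    gaussianPair ι {ω | ω.1 ∈ s} = stdGaussianPi ι s := by
  have : {ω : (ι → ℝ) × (ι → ℝ) | ω.1 ∈ s} = s ×ˢ Set.univ := by
    ext ω; simp
  rw [this, gaussianPair, Measure.prod_prod, measure_univ, mul_one]

/-- The constant in the net arguments. -/
def netConst (d : ℕ) : ℝ := (2 * d + 1) * Real.log 25 + (d + 5)

theorem netConst_pos (d : ℕ) : 0 < netConst d := by
  have := Real.log_nonneg (show (1 : ℝ) ≤ 25 by norm_num)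
  unfold netConst
  positivity

theorem gaussianPair_admissible_le (hd : 1 ≤ d) (hN : 1 ≤ N) (S : Fin d → Finset (Fin N))
    (hS : ∀ j, (S j).Nonempty) :
    gaussianPair (Fin d → Fin N) {ω | ¬ ∀ A B, IsAdmissible S A → IsAdmissible S B →
        ‖(fun i => (ω.1 i : ℂ)) ⬝ᵥ
            (tensorMatrix (fun j => A j * (B j)ᵀ) *ᵥ fun i => (ω.2 i : ℂ))‖ ≤
          8 * 8 ^ d * netConst d * N * √(∏ j, ((S j).card : ℝ))} ≤
      ENNReal.ofReal (8 * Real.exp (-((d + 5) * N))) := by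
  have : Nonempty (Fin d) := ⟨⟨0, hd⟩⟩
  -- The frozen leg has the largest support. Hence `L * (N * ρ) = N² ∏ |S j|`, and the two bounds
  -- multiply to `N √(∏ |S j|)`.
  obtain ⟨j₀, hj₀⟩ := Finite.exists_max fun j => (S j).card
  set a := netConst d with ha
  have ha0 : 0 < a := netConst_pos d
  set ρ := (S j₀).card with hρ
  have hρ1 : 1 ≤ ρ := (hS j₀).card_pos
  obtain ⟨L, hL⟩ : ∃ L, L = N * ∏ j ∈ Finset.univ.erase j₀, (S j).card := ⟨_, rfl⟩
  have hLN : N ≤ L := by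
    rw [hL]
    exact Nat.le_mul_of_pos_right _ (Finset.prod_pos fun j _ => (hS j).card_pos)
  have hL0 : (0 : ℝ) < L := by exact_mod_cast hN.trans hLN
  set σ := 2 * (2 ^ d * (2 * √(a * L))) with hσ
  have hσ0 : 0 < σ := by positivity
  have hval : 2 ^ d * (2 ^ d * (2 * σ * √(a * (N * ρ : ℕ)))) =
      8 * 8 ^ d * a * N * √(∏ j, ((S j).card : ℝ)) := by
    have h1 : √(a * L) * √(a * (N * ρ : ℕ)) = a * N * √(∏ j, ((S j).card : ℝ)) := by
      rw [← Real.sqrt_mul (by positivity)]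
      have : a * L * (a * (N * ρ : ℕ)) = (a * N) ^ 2 * ∏ j, ((S j).card : ℝ) := by
        rw [← Finset.mul_prod_erase _ _ (Finset.mem_univ j₀), hL]
        push_cast
        ring
      rw [this, Real.sqrt_mul (by positivity), Real.sqrt_sq (by positivity)]
    have h2 : (8 : ℝ) ^ d = 2 ^ d * 2 ^ d * 2 ^ d := by
      rw [← mul_pow, ← mul_pow]; norm_num
    rw [hσ, h2]
    linear_combination (8 * (2 ^ d * 2 ^ d * 2 ^ d)) * h1
  have h1 := measure_transpose_mulVec_le S j₀ hS ha0.le hL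
  have h2 := gaussianPair_form_le S hj₀ ha0.le hσ0
  rw [hval] at h2
  rw [← gaussianPair_snd_preimage] at h1
  refine (measure_mono ?_).trans ((measure_union_le _ _).trans (add_le_add h1 h2)) |>.trans ?_
  · intro ω hω
    by_cases h : ∀ B, IsAdmissible S B →
        ∑ k, ‖((tensorMatrix B)ᵀ *ᵥ fun i => (ω.2 i : ℂ)) k‖ ^ 2 ≤ σ ^ 2
    · exact Or.inr ⟨h, hω⟩
    · exact Or.inl h
  · rw [← ENNReal.ofReal_add (by positivity) (by positivity)]
    refine ENNReal.ofReal_le_ofReal ?_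
    have hlog : 0 ≤ Real.log 25 := Real.log_nonneg (by norm_num)
    have hd0 : (0 : ℝ) ≤ d := Nat.cast_nonneg d
    have hL' : (N : ℝ) ≤ L := by exact_mod_cast hLN
    have hρ' : (N : ℝ) ≤ (N * ρ : ℕ) := by exact_mod_cast Nat.le_mul_of_pos_right _ hρ1
    -- In `netConst`, the coefficient `2 * d + 1` of `log 25` covers both net exponents, `d + 1` and
    -- `2 * d`. The summand `d + 5` is the decay that remains.
    have e1 : ((d + 1) * L : ℕ) * Real.log 25 - a * L ≤ -((d + 5) * N) := by
      rw [ha, netConst]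
      push_cast
      nlinarith [mul_nonneg (mul_nonneg hd0 hL0.le) hlog]
    have e2 : (2 * d * (N * ρ) : ℕ) * Real.log 25 - a * (N * ρ : ℕ) ≤ -((d + 5) * N) := by
      rw [ha, netConst, Nat.cast_mul (2 * d)]
      generalize ((N * ρ : ℕ) : ℝ) = m at hρ'
      push_cast
      nlinarith [mul_nonneg ((Nat.cast_nonneg N).trans hρ') hlog]
    linarith [Real.exp_le_exp.2 e1, Real.exp_le_exp.2 e2]

/-- There are `2 ^ (d N) ≤ exp (d N)` choices of supports and `8 ≤ exp (3 N)`, so the decay `exp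
(-(d + 5) N)` leaves `exp (-2 N)`. -/
theorem gaussianPair_forall_admissible_le (hd : 1 ≤ d) (hN : 1 ≤ N) :
    gaussianPair (Fin d → Fin N) {ω | ¬ ∀ S : Fin d → Finset (Fin N), (∀ j, (S j).Nonempty) →
        ∀ A B, IsAdmissible S A → IsAdmissible S B →
        ‖(fun i => (ω.1 i : ℂ)) ⬝ᵥ
            (tensorMatrix (fun j => A j * (B j)ᵀ) *ᵥ fun i => (ω.2 i : ℂ))‖ ≤
          8 * 8 ^ d * netConst d * N * √(∏ j, ((S j).card : ℝ))} ≤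
      ENNReal.ofReal (Real.exp (-(2 * N))) := by
  classical
  let E : (Fin d → Finset (Fin N)) → Set (((Fin d → Fin N) → ℝ) × ((Fin d → Fin N) → ℝ)) :=
    fun S => {ω | (∀ j, (S j).Nonempty) ∧ ¬ ∀ A B, IsAdmissible S A → IsAdmissible S B →
        ‖(fun i => (ω.1 i : ℂ)) ⬝ᵥ
            (tensorMatrix (fun j => A j * (B j)ᵀ) *ᵥ fun i => (ω.2 i : ℂ))‖ ≤
          8 * 8 ^ d * netConst d * N * √(∏ j, ((S j).card : ℝ))}
  have hE : ∀ S ∈ Finset.univ, gaussianPair (Fin d → Fin N) (E S) ≤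
      ENNReal.ofReal (8 * Real.exp (-((d + 5) * N))) := by
    intro S _
    by_cases hS : ∀ j, (S j).Nonempty
    · exact (measure_mono fun ω hω => hω.2).trans (gaussianPair_admissible_le hd hN S hS)
    · have : E S = ∅ := by
        ext ω
        simp only [E, hS, false_and, Set.mem_ofPred_eq, Set.mem_empty_iff_false]
      rw [this, measure_empty]
      exact zero_le
  have hcard : (Finset.univ : Finset (Fin d → Finset (Fin N))).card ≤ (2 ^ N) ^ d := by
    simp
  refine (measure_mono (t := ⋃ S ∈ Finset.univ, E S) fun ω hω => ?_).trans
    ((measure_biUnion_le_card _ _ E hcard hE).trans (ENNReal.ofReal_le_ofReal ?_))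
  · simp only [Set.mem_ofPred_eq, not_forall] at hω
    obtain ⟨S, hS, A, B, hA, hB, h⟩ := hω
    exact Set.mem_biUnion (Finset.mem_univ S) ⟨hS, fun h' => h (h' A B hA hB)⟩
  · have hN' : (1 : ℝ) ≤ N := by exact_mod_cast hN
    have h2 : ((2 ^ N) ^ d : ℝ) ≤ Real.exp (d * N) := by
      rw [← pow_mul, show (d : ℝ) * N = ((N * d : ℕ) : ℝ) * 1 by push_cast; ring, Real.exp_nat_mul]
      refine pow_le_pow_left₀ zero_le_two ?_ _
      linarith [Real.add_one_le_exp (1 : ℝ)]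
    have h8 : (8 : ℝ) ≤ Real.exp (3 * N) := by
      have h3 : (8 : ℝ) ≤ Real.exp 3 := by
        have : Real.exp 3 = Real.exp 1 ^ 3 := by rw [← Real.exp_nat_mul]; norm_num
        rw [this]
        have := pow_le_pow_left₀ zero_le_two
          (show (2 : ℝ) ≤ Real.exp 1 by linarith [Real.add_one_le_exp (1 : ℝ)]) 3
        linarith
      exact h3.trans (Real.exp_le_exp.2 (by linarith))
    push_cast
    calc (2 ^ N) ^ d * (8 * Real.exp (-((d + 5) * N)))
        ≤ Real.exp (d * N) * (Real.exp (3 * N) * Real.exp (-((d + 5) * N))) := by gcongr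
      _ = Real.exp (-(2 * N)) := by
          rw [← Real.exp_add, ← Real.exp_add]
          congr 1
          ring

end GaussianTensor

/-! ### The injective norm of a rank one tensor -/

section InjectiveNorm

open scoped Matrix

variable {d N : ℕ}

theorem tensorMatrix_smul (s : Fin d → ℂ) (X : Fin d → Matrix (Fin N) (Fin N) ℂ) :
    tensorMatrix (fun j => s j • X j) = (∏ j, s j) • tensorMatrix X := by
  ext i k
  simp [tensorMatrix_apply, Finset.prod_mul_distrib]

/-- The injective norm is controlled, up to a logarithmic factor for each leg, by the values on
normalized products of contractions. -/
theorem injNormHilbert_rankOne_le (g g' : (Fin d → Fin N) → ℂ) {K : ℝ} (hK : 0 ≤ K)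
    (h : ∀ S : Fin d → Finset (Fin N), (∀ j, (S j).Nonempty) →
      ∀ A B, IsAdmissible S A → IsAdmissible S B →
        ‖g ⬝ᵥ (tensorMatrix (fun j => A j * (B j)ᵀ) *ᵥ g')‖ ≤ K * √(∏ j, ((S j).card : ℝ))) :
    injNormHilbert (rankOne (N := fun _ => N) g g') ≤ √(harmonic N) ^ d * K := by
  refine Real.sSup_le ?_ (by positivity)
  rintro _ ⟨x, hx, rfl⟩
  -- The test set of every leg consists of the normalized products of contractions with all supports
  -- at once; `Q` is the Hilbert–Schmidt ball. The passage from `P` to `Q` costs `√(harmonic N)` per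
  -- leg.
  let P : Fin d → Set (Fin N × Fin N → ℂ) := fun _ => {y | ∃ S : Finset (Fin N), S.Nonempty ∧
    ∃ A B : Matrix (Fin N) (Fin N) ℂ, (A ∈ colSupport (Fin N) S ∧ IsContraction A) ∧
      (B ∈ colSupport (Fin N) S ∧ IsContraction B) ∧
      y = fun p => ((√(S.card : ℝ))⁻¹ : ℂ) * (A * Bᵀ) p.1 p.2}
  let Q : Fin d → Set (Fin N × Fin N → ℂ) := fun _ => {y | ∑ p, ‖y p‖ ^ 2 ≤ 1}
  rw [← multiformMap_apply]
  refine (norm_le_of_forall_legs (c := √(harmonic N)) (M := K)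
    (multiformMap (ι := fun _ : Fin d => Fin N × Fin N) (rankOne (N := fun _ => N) g g')) P Q
    ?_ ?_ fun j => ?_).trans (by rw [Fintype.card_fin])
  · intro j l M hM y hy
    rcases isEmpty_or_nonempty (Fin N) with hN | hN
    · have : y = 0 := Subsingleton.elim _ _
      have hN0 : N = 0 := by
        by_contra h0
        exact hN.elim ⟨0, Nat.pos_of_ne_zero h0⟩
      subst hN0
      simp [this]
    let m : Matrix (Fin N) (Fin N) ℂ := Matrix.of fun i k => l (Pi.single (i, k) 1)
    have hl : ∀ y : Fin N × Fin N → ℂ, l y = ∑ i, ∑ k, m i k * y (i, k) := by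
      intro y
      rw [← Fintype.sum_prod_type' (fun i k => m i k * y (i, k))]
      conv_lhs => rw [pi_eq_sum_univ' y]
      rw [map_sum]
      refine Finset.sum_congr rfl fun p _ => ?_
      rw [map_smul, smul_eq_mul, mul_comm]
      congr 2
    have hM0 : 0 ≤ M := by
      refine (norm_nonneg _).trans (hM
        (fun p => ((√((Finset.univ : Finset (Fin N)).card : ℝ))⁻¹ : ℂ) *
          ((1 : Matrix (Fin N) (Fin N) ℂ) * (1 : Matrix (Fin N) (Fin N) ℂ)ᵀ) p.1 p.2)
        ⟨Finset.univ, Finset.univ_nonempty, 1, 1,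
          ⟨fun i k hk => absurd (Finset.mem_univ k) hk, isContraction_one⟩,
          ⟨fun i k hk => absurd (Finset.mem_univ k) hk, isContraction_one⟩, rfl⟩)
    have hHS := sum_norm_sq_le_of_partial_isometries m (K := M) fun S hS A B hA hB hA1 hB1 => by
      have h1 := hM _ ⟨S, hS, A, B, ⟨hA, hA1⟩, ⟨hB, hB1⟩, rfl⟩
      have hs : 0 < √(S.card : ℝ) := Real.sqrt_pos.2 (by exact_mod_cast hS.card_pos)
      have h2 : l (fun p => ((√(S.card : ℝ))⁻¹ : ℂ) * (A * Bᵀ) p.1 p.2) =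
          ((√(S.card : ℝ))⁻¹ : ℂ) * ∑ i, ∑ k, m i k * (A * Bᵀ) i k := by
        rw [hl]
        simp only [Finset.mul_sum]
        exact Finset.sum_congr rfl fun i _ => Finset.sum_congr rfl fun k _ => by ring
      rw [h2, norm_mul, norm_inv, Complex.norm_real, Real.norm_of_nonneg hs.le,
        inv_mul_le_iff₀ hs] at h1
      linarith
    rw [Fintype.card_fin] at hHS
    rw [hl, ← Fintype.sum_prod_type' (fun i k => m i k * y (i, k))]
    rw [← Fintype.sum_prod_type' (fun i k => ‖m i k‖ ^ 2)] at hHS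
    calc ‖∑ p : Fin N × Fin N, m p.1 p.2 * y (p.1, p.2)‖
        ≤ ∑ p : Fin N × Fin N, ‖m p.1 p.2‖ * ‖y p‖ :=
          (norm_sum_le _ _).trans (Finset.sum_le_sum fun p _ => (norm_mul _ _).le)
      _ ≤ √(∑ p : Fin N × Fin N, ‖m p.1 p.2‖ ^ 2) * √(∑ p, ‖y p‖ ^ 2) :=
          Real.sum_mul_le_sqrt_mul_sqrt _ _ _
      _ ≤ √(M ^ 2 * harmonic N) * 1 :=
          mul_le_mul (Real.sqrt_le_sqrt hHS) (Real.sqrt_le_one.2 hy) (Real.sqrt_nonneg _)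
            (Real.sqrt_nonneg _)
      _ = √(harmonic N) * M := by
          rw [mul_one, Real.sqrt_mul (sq_nonneg M), Real.sqrt_sq hM0, mul_comm]
  · intro y hy
    choose S hS A B hA hB hAB using hy
    rw [multiformMap_apply, multiform_rankOne]
    have h1 : (fun j => Matrix.of fun a b => y j (a, b)) =
        fun j => ((√((S j).card : ℝ))⁻¹ : ℂ) • (A j * (B j)ᵀ) := by
      funext j
      ext a b
      rw [hAB j]
      rfl
    rw [h1, tensorMatrix_smul, Matrix.smul_mulVec, dotProduct_smul, norm_smul, norm_prod]
    simp_rw [norm_inv, Complex.norm_real, Real.norm_of_nonneg (Real.sqrt_nonneg _)]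
    have h2 := h S hS A B hA hB
    have h3 : ∀ j, 0 < √((S j).card : ℝ) := fun j =>
      Real.sqrt_pos.2 (by exact_mod_cast (hS j).card_pos)
    rw [Finset.prod_inv_distrib, inv_mul_le_iff₀ (Finset.prod_pos fun j _ => h3 j)]
    rw [Real.sqrt_prod _ fun _ _ => Nat.cast_nonneg _] at h2
    linarith
  · have := hx j
    rw [EuclideanSpace.norm_eq, Real.sqrt_le_one] at this
    exact this

theorem harmonic_le_three_mul_log (hN : 2 ≤ N) : (harmonic N : ℝ) ≤ 3 * Real.log N := by
  have h1 := harmonic_le_one_add_log N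
  have h2 : Real.log 2 ≤ Real.log N := Real.log_le_log zero_lt_two (by exact_mod_cast hN)
  have h3 := Real.log_two_gt_d9
  linarith

theorem injNormHilbert_realRankOne_le (hN : 2 ≤ N)
    (ω : ((Fin d → Fin N) → ℝ) × ((Fin d → Fin N) → ℝ)) {K : ℝ} (hK : 0 ≤ K)
    (h : ∀ S : Fin d → Finset (Fin N), (∀ j, (S j).Nonempty) →
      ∀ A B, IsAdmissible S A → IsAdmissible S B →
        ‖(fun i => (ω.1 i : ℂ)) ⬝ᵥ
            (tensorMatrix (fun j => A j * (B j)ᵀ) *ᵥ fun i => (ω.2 i : ℂ))‖ ≤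
          K * N * √(∏ j, ((S j).card : ℝ))) :
    injNormHilbert (realRankOne (N := fun _ => N) ω) ≤
      √3 ^ d * K * (N * Real.log N ^ ((d : ℝ) / 2)) := by
  refine (injNormHilbert_rankOne_le _ _ (mul_nonneg hK (Nat.cast_nonneg N)) h).trans ?_
  have hlog : 0 ≤ Real.log N := Real.log_natCast_nonneg N
  have h1 : √(harmonic N : ℝ) ^ d ≤ √3 ^ d * Real.log N ^ ((d : ℝ) / 2) := by
    have h2 : Real.log N ^ ((d : ℝ) / 2) = √(Real.log N) ^ d := by
      rw [Real.sqrt_eq_rpow, ← Real.rpow_natCast, ← Real.rpow_mul hlog]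
      congr 1
      ring
    rw [h2, ← mul_pow, ← Real.sqrt_mul zero_le_three]
    exact pow_le_pow_left₀ (Real.sqrt_nonneg _) (Real.sqrt_le_sqrt (harmonic_le_three_mul_log hN)) _
  calc √(harmonic N : ℝ) ^ d * (K * N)
      ≤ (√3 ^ d * Real.log N ^ ((d : ℝ) / 2)) * (K * N) :=
        mul_le_mul_of_nonneg_right h1 (by positivity)
    _ = _ := by ring

end InjectiveNorm

/-! ### The Gaussian tensor and the resulting lower bound -/

section Main

open MeasureTheory

theorem exists_gaussian_bounds (d : ℕ) (hd : 1 ≤ d) :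
    ∃ c > (0 : ℝ), ∃ C > (0 : ℝ), ∃ κ > (0 : ℝ), ∀ N : ℕ, 2 ≤ N →
      ∀ v : Fin d → Fin (N ^ 2) → Matrix (Fin N) (Fin N) ℂ, (∀ j, IsUnitaryBasis (v j)) →
        gaussianPair (Fin d → Fin N)
          {ω | ¬ (c * (N : ℝ) ^ d ≤
                  minNorm (basisCoeff (N := fun _ => N) v (realRankOne (N := fun _ => N) ω)) ∧
                injNormHilbert (realRankOne (N := fun _ => N) ω) ≤
                  C * ((N : ℝ) * Real.log N ^ ((d : ℝ) / 2)) ∧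
                injNorm (basisCoeff (N := fun _ => N) v (realRankOne (N := fun _ => N) ω)) ≤
                  C * ((N : ℝ) ^ ((d : ℝ) / 2) * ((N : ℝ) * Real.log N ^ ((d : ℝ) / 2))))} ≤
          ENNReal.ofReal (Real.exp (-κ * N)) := by
  obtain ⟨δ, hδ, hsmall⟩ := exists_measure_sum_sq_le
  have hK : 0 < 8 * 8 ^ d * netConst d := mul_pos (by positivity) (netConst_pos d)
  refine ⟨δ, hδ, √3 ^ d * (8 * 8 ^ d * netConst d), by positivity, 1, one_pos,
    fun N hN v hv => ?_⟩
  have hN1 : 1 ≤ N := by omega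
  have hs := hsmall (Fin d → Fin N)
  have hs2 := hs
  rw [← gaussianPair_snd_preimage] at hs2
  rw [← gaussianPair_fst_preimage] at hs
  have hE := gaussianPair_forall_admissible_le hd hN1
  refine (measure_mono ?_).trans ((measure_union_le _ _).trans (add_le_add hE
    ((measure_union_le _ _).trans (add_le_add hs hs2)))) |>.trans ?_
  · intro ω hω
    by_contra hn
    simp only [Set.mem_union, not_or, Set.mem_ofPred_eq, not_not, not_le] at hn
    obtain ⟨h1, h2, h3⟩ := hn
    have hinj := injNormHilbert_realRankOne_le hN ω hK.le h1
    refine hω ⟨?_, hinj, ?_⟩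
    · refine le_trans ?_ (l2Norm_mul_le_minNorm (N := fun _ => N) (fun _ => hN1) hv _ _)
      simp only [Fintype.card_pi, Fintype.card_fin, Finset.prod_const, Finset.card_univ,
        Nat.cast_pow] at h2 h3
      simp only [l2Norm, Complex.norm_real, Real.norm_eq_abs, sq_abs]
      have hp : 0 ≤ δ * (N : ℝ) ^ d := by positivity
      calc δ * (N : ℝ) ^ d = √(δ * (N : ℝ) ^ d) * √(δ * (N : ℝ) ^ d) :=
            (Real.mul_self_sqrt hp).symm
        _ ≤ _ := mul_le_mul (Real.sqrt_le_sqrt h2.le) (Real.sqrt_le_sqrt h3.le)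
            (Real.sqrt_nonneg _) (Real.sqrt_nonneg _)
    · refine (injNorm_basisCoeff_le (N := fun _ => N) (fun _ => hN1) hv _).trans ?_
      have hpow : (∏ _j : Fin d, (N : ℝ)) ^ (1 / 2 : ℝ) = (N : ℝ) ^ ((d : ℝ) / 2) := by
        rw [Finset.prod_const, Finset.card_univ, Fintype.card_fin, ← Real.rpow_natCast,
          ← Real.rpow_mul (Nat.cast_nonneg N)]
        congr 1
        ring
      rw [hpow]
      refine (mul_le_mul_of_nonneg_left hinj (by positivity)).trans (le_of_eq ?_)
      ring
  · rw [← ENNReal.ofReal_add (by positivity) (by positivity),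
      ← ENNReal.ofReal_add (by positivity) (by positivity)]
    refine ENNReal.ofReal_le_ofReal ?_
    have hN2 : (2 : ℝ) ≤ N := by exact_mod_cast hN
    have hcard : (N : ℝ) ≤ Fintype.card (Fin d → Fin N) := by
      simp only [Fintype.card_pi, Fintype.card_fin, Finset.prod_const, Finset.card_univ]
      exact_mod_cast Nat.le_self_pow (by omega) N
    -- Each of the three bad events has probability at most `exp (-2 N)`, and `3 ≤ exp N` because `N
    -- ≥ 2`; hence `κ = 1`.
    have e1 : Real.exp (-3 * Fintype.card (Fin d → Fin N)) ≤ Real.exp (-(2 * N)) :=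
      Real.exp_le_exp.2 (by linarith)
    have e2 : 3 * Real.exp (-(2 * N)) ≤ Real.exp (-1 * N) := by
      have h3 : (3 : ℝ) ≤ Real.exp N := by linarith [Real.add_one_le_exp (N : ℝ)]
      calc 3 * Real.exp (-(2 * N)) ≤ Real.exp N * Real.exp (-(2 * N)) := by gcongr
        _ = Real.exp (-1 * N) := by
            rw [← Real.exp_add]
            congr 1
            ring
    linarith

theorem exists_notMem_of_measure_lt_one {Ω : Type*} [MeasurableSpace Ω] {μ : Measure Ω}
    [IsProbabilityMeasure μ] {s : Set Ω} (h : μ s < 1) : ∃ ω, ω ∉ s := by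
  refine (Set.ne_univ_iff_exists_notMem s).1 fun h0 => ?_
  rw [h0, measure_univ] at h
  exact h.false

theorem exists_lower_bound_bellConst (d : ℕ) (hd : 1 ≤ d) :
    ∃ c > (0 : ℝ), ∀ N : ℕ, 2 ≤ N →
      c * (N : ℝ) ^ ((d : ℝ) / 2 - 1) * Real.log N ^ (-((d : ℝ) / 2)) ≤
        bellConst (fun _ : Fin d => N ^ 2) := by
  obtain ⟨c, hc, C, hC, κ, hκ, h⟩ := exists_gaussian_bounds d hd
  refine ⟨c / C, div_pos hc hC, fun N hN => ?_⟩
  obtain ⟨v, hv⟩ := exists_isUnitaryBasis (N := N) (by omega)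
  have hN0 : (0 : ℝ) < N := by exact_mod_cast (by omega : 0 < N)
  have hlog : 0 < Real.log N := Real.log_pos (by exact_mod_cast (by omega : 1 < N))
  have hlt : ENNReal.ofReal (Real.exp (-κ * N)) < 1 := by
    rw [ENNReal.ofReal_lt_one, Real.exp_lt_one_iff]
    nlinarith
  have hm := (h N hN (fun _ => v) fun _ => hv).trans_lt hlt
  have : IsProbabilityMeasure (gaussianPair (Fin d → Fin N)) := by
    unfold gaussianPair
    infer_instance
  -- Since the failure probability is below one, some sample satisfies all the bounds. Their
  -- quotient has exponent `d - d/2 - 1 = d/2 - 1` in `N`.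
  obtain ⟨ω, hω⟩ := exists_notMem_of_measure_lt_one hm
  rw [Set.mem_ofPred_eq, not_not] at hω
  obtain ⟨h1, -, h2⟩ := hω
  refine le_trans ?_ (minNorm_div_le_bellConst (by positivity) h2)
  rw [le_div_iff₀ (by positivity)]
  refine le_trans (le_of_eq ?_) h1
  rw [Real.rpow_neg hlog.le, Real.rpow_sub hN0, Real.rpow_one]
  have e : (N : ℝ) ^ ((d : ℝ) / 2) * (N : ℝ) ^ ((d : ℝ) / 2) = (N : ℝ) ^ d := by
    rw [← Real.rpow_add hN0, ← Real.rpow_natCast]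
    congr 1
    ring
  rw [← e]
  have := (Real.rpow_pos_of_pos hlog ((d : ℝ) / 2)).ne'
  field_simp

end Main

end BellTensor

end

theorem mainTheorem4 (d : ℕ) (hd : 1 ≤ d) :
    -- general dimensions: the tensor `t` built from an arbitrary rank one tensor `T`
    (∀ N : Fin d → ℕ, (∀ j, 1 ≤ N j) →
      (∀ (v : ∀ j, Fin (N j ^ 2) → Matrix (Fin (N j)) (Fin (N j)) ℂ),
        (∀ j, BellTensor.IsUnitaryBasis (v j)) →
        ∀ g g' : (∀ j, Fin (N j)) → ℂ,
          BellTensor.l2Norm g * BellTensor.l2Norm g' ≤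
              BellTensor.minNorm (BellTensor.basisCoeff v (BellTensor.rankOne g g')) ∧
            BellTensor.injNorm (BellTensor.basisCoeff v (BellTensor.rankOne g g')) ≤
              (∏ j, (N j : ℝ)) ^ (1 / 2 : ℝ) *
                BellTensor.injNormHilbert (BellTensor.rankOne g g')) ∧
      (∀ g g' : (∀ j, Fin (N j)) → ℂ, BellTensor.l2Norm g * BellTensor.l2Norm g' = 1 →
        (∏ j, (N j : ℝ)) ^ (-(1 / 2) : ℝ) *
            (BellTensor.injNormHilbert (BellTensor.rankOne g g'))⁻¹ ≤
          BellTensor.bellConst (fun j => N j ^ 2))) ∧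
    -- equal dimensions: the Gaussian tensor, with large probability
    (∃ c > (0 : ℝ), ∃ C > (0 : ℝ), ∃ κ > (0 : ℝ), ∀ N : ℕ, 2 ≤ N →
      ∀ v : Fin d → Fin (N ^ 2) → Matrix (Fin N) (Fin N) ℂ,
        (∀ j, BellTensor.IsUnitaryBasis (v j)) →
        BellTensor.gaussianPair (Fin d → Fin N)
          {ω | ¬ (c * (N : ℝ) ^ d ≤
                  BellTensor.minNorm
                    (BellTensor.basisCoeff (N := fun _ => N) v
                      (BellTensor.realRankOne (N := fun _ => N) ω)) ∧
                BellTensor.injNormHilbert (BellTensor.realRankOne (N := fun _ => N) ω) ≤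
                  C * ((N : ℝ) * Real.log N ^ ((d : ℝ) / 2)) ∧
                BellTensor.injNorm
                    (BellTensor.basisCoeff (N := fun _ => N) v
                      (BellTensor.realRankOne (N := fun _ => N) ω)) ≤
                  C * ((N : ℝ) ^ ((d : ℝ) / 2) * ((N : ℝ) * Real.log N ^ ((d : ℝ) / 2))))} ≤
          ENNReal.ofReal (Real.exp (-κ * N))) ∧
    -- the resulting lower bound
    (∃ c > (0 : ℝ), ∀ N : ℕ, 2 ≤ N →
      c * (N : ℝ) ^ ((d : ℝ) / 2 - 1) * Real.log N ^ (-((d : ℝ) / 2)) ≤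
        BellTensor.bellConst (fun _ : Fin d => N ^ 2)) := by
  obtain ⟨c, hc, h⟩ := BellTensor.exists_lower_bound_bellConst d hd
  exact ⟨fun N hN => ⟨fun v hv g g' => ⟨BellTensor.l2Norm_mul_le_minNorm hN hv g g',
    BellTensor.injNorm_basisCoeff_le hN hv _⟩, fun g g' h => BellTensor.le_bellConst hN g g' h⟩,
    BellTensor.exists_gaussian_bounds d hd, c, hc, h⟩
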